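/- Let $k$ be a field, let $K$ be an algebraically closed field containing $k$ (for instance $K=k$ if $k$ is algebraically closed), and let $S=k[x_{00},x_{01},x_{02},x_{11},x_{12},x_{22}]$, with all variables of degree $1$. Let $\sigma:\mathbb P^2\to\mathbb P^5$, $(a_0:a_1:a_2)\mapsto(a_0^2:a_0a_1:a_0a_2:a_1^2:a_1a_2:a_2^2)$ be the Veronese embedding, let $\theta:S\to k[x_0,x_1,x_2]$ be the $k$-algebra homomorphism with $\theta(x_{ij})=x_ix_j$, and put $$\Delta_{00}=x_{11}x_{22}-x_{12}^2,\quad \Delta_{01}=x_{01}x_{22}-x_{12}x_{02},\quad \Delta_{02}=x_{01}x_{12}-x_{02}x_{11},$$ $$\Delta_{11}=x_{00}x_{22}-x_{02}^2,\quad \Delta_{12}=x_{00}x_{12}-x_{02}x_{01},\quad \Delta_{22}=x_{00}x_{11}-x_{01}^2.$$ Let $M_1=(\Delta_{00},\Delta_{01},\Delta_{02},\Delta_{11},\Delta_{12},\Delta_{22})$, $$M_2=\begin{pmatrix} x_{02}&0&x_{01}&0&0&x_{00}&0&0\\ -x_{12}&x_{02}&-x_{11}&x_{01}&0&0&x_{00}&0\\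 x_{22}&0&x_{12}&x_{02}&x_{01}&x_{02}&0&x_{00}\\ 0&-x_{12}&0&-x_{11}&0&-x_{11}&-x_{01}&0\\ 0&x_{22}&0&0&-x_{11}&x_{12}&x_{02}&-x_{01}\\ 0&0&0&x_{22}&x_{12}&0&0&x_{02}\end{pmatrix},\qquad M_3=\begin{pmatrix} x_{01}&x_{00}&0\\-x_{11}&-x_{01}&0\\-x_{02}&0&x_{00}\\x_{12}&x_{02}&0\\-x_{22}&0&x_{02}\\0&-x_{02}&-x_{01}\\0&x_{12}&x_{11}\\0&-x_{22}&-x_{12}\end{pmatrix}.$$ The homogeneous ideal of a set $Y$ of points of projective space (with coordinates in $K$) is the ideal generated by the homogeneous polynomials over $k$ that vanish on $Y$. The complex $$V:\quad 0\to S(-4)^3\xrightarrow{M_3}S(-3)^8\xrightarrow{M_2}S(-2)^6\xrightarrow{M_1}S$$ is a minimal graded free resolution of $S/I$, where $I$ is the homogeneous ideal of $\sigma(\mathbb P^2)$. Let $m\ge 1$, let $f=\sum a_{ijl}x_0^ix_1^jx_2^l\in k[x_0,x_1,x_2]$ be an irreducible homogeneous polynomial of degree $2m$, and let $C\subset\mathbb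 P^2$ be the curve of its zeros. Then $f$ has a lift of degree $m$ through $\theta$, namely the form $\sum a_{ijl}\,x_{00}^{\lfloor i/2\rfloor}x_{11}^{\lfloor j/2\rfloor}x_{22}^{\lfloor l/2\rfloor}\,y_{ijl}$, where $y_{ijl}=1$ if $i,j,l$ are all even, and otherwise $y_{ijl}$ is $x_{12}$, $x_{02}$ or $x_{01}$ according to whether $i$, $j$ or $l$ is the only even exponent. For this lift, and more generally for every form $F\in S$ of degree $m$ with $\theta(F)=f$, the following hold. 1. The homogeneous ideal $I_C$ of $\sigma(C)\subset\mathbb P^5$ is generated by the six minors $\Delta_{ij}$ together with $F$. 2. The sequence $$0\to S(-m-4)^3\xrightarrow{M_4'}S(-4)^3\oplus S(-m-3)^8\xrightarrow{M_3'}S(-3)^8\oplus S(-m-2)^6\xrightarrow{M_2'}S(-2)^6\oplus S(-m)\xrightarrow{M_1'}S\to S/I_C\to 0$$ is a minimal graded free resolution of $S/I_C$ (it is exact, all maps have degree $0$, and no matrix entry has a nonzero constant term), where $$M_1'=\begin{pmatrix}M_1&F\end{pmatrix},\quad M_2'=\begin{pmatrix}M_2&-F\,I_6\\0&M_1\end{pmatrix},\quad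 M_3'=\begin{pmatrix}M_3&F\,I_8\\0&M_2\end{pmatrix},\quad M_4'=\begin{pmatrix}-F\,I_3\\M_3\end{pmatrix}.$$ 3. The complex of free modules in 2 is isomorphic, as a complex of graded $S$-modules, to the mapping cone of multiplication by $F$, $V(-m)\to V$. -/

import Mathlib

open MvPolynomial

namespace VeroneseCurve

/-- The homogeneous coordinate ring `S = k[x₀₀, x₀₁, x₀₂, x₁₁, x₁₂, x₂₂]` of `ℙ⁵`; the variables
are indexed by `0, …, 5` in this order and all have degree `1`. -/
abbrev S (k : Type*) [CommSemiring k] := MvPolynomial (Fin 6) k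

section Geometry

/-- `(a₀, a₁, a₂) ↦ (a₀², a₀a₁, a₀a₂, a₁², a₁a₂, a₂²)`. -/
def veroneseVec {R : Type*} [CommSemiring R] (a : Fin 3 → R) : Fin 6 → R :=
  ![a 0 ^ 2, a 0 * a 1, a 0 * a 2, a 1 ^ 2, a 1 * a 2, a 2 ^ 2]

theorem veroneseVec_ne_zero {K : Type*} [Field K] {a : Fin 3 → K} (ha : a ≠ 0) :
    veroneseVec a ≠ 0 := by
  intro h
  apply ha
  have h0 : a 0 ^ 2 = 0 := congrFun h 0
  have h1 : a 1 ^ 2 = 0 := congrFun h 3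
  have h2 : a 2 ^ 2 = 0 := congrFun h 5
  funext i
  fin_cases i
  · exact pow_eq_zero_iff (two_ne_zero) |>.1 h0
  · exact pow_eq_zero_iff (two_ne_zero) |>.1 h1
  · exact pow_eq_zero_iff (two_ne_zero) |>.1 h2

theorem veroneseVec_smul {K : Type*} [Field K] (t : K) (a : Fin 3 → K) :
    veroneseVec (t • a) = t ^ 2 • veroneseVec a := by
  funext i
  fin_cases i <;> simp [veroneseVec] <;> ring

/-- The Veronese embedding `σ : ℙ² → ℙ⁵`. -/
def veronese (K : Type*) [Field K] :
    Projectivization K (Fin 3 → K) → Projectivization K (Fin 6 → K) :=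
  Projectivization.lift
    (fun a => Projectivization.mk K (veroneseVec a.1) (veroneseVec_ne_zero a.2))
    (by
      rintro ⟨a, ha⟩ ⟨b, hb⟩ t h
      have h' : a = t • b := h
      rw [Projectivization.mk_eq_mk_iff']
      exact ⟨t ^ 2, by simp only [h', veroneseVec_smul]⟩)

/-- `G` vanishes at the point `p` of projective space over an extension field `K` of `k`: it
vanishes at every coordinate vector of `p` (one suffices if `G` is homogeneous). -/
def VanishesAt {k : Type*} {K : Type*} [Field k] [Field K] [Algebra k K] {n : ℕ}
    (G : MvPolynomial (Fin n) k) (p : Projectivization K (Fin n → K)) : Prop :=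
  ∀ (v : Fin n → K) (hv : v ≠ 0), Projectivization.mk K v hv = p → aeval v G = 0

/-- The set `𝒵(f)` of points (with coordinates in `K`) at which `f` vanishes. -/
def zeroSet {k : Type*} (K : Type*) [Field k] [Field K] [Algebra k K] {n : ℕ}
    (f : MvPolynomial (Fin n) k) : Set (Projectivization K (Fin n → K)) :=
  {p | VanishesAt f p}

/-- The homogeneous ideal of a set `Y` of points of projective space: the ideal generated by the
homogeneous polynomials (with coefficients in `k`) that vanish at every point of `Y`. -/
noncomputable def homogeneousIdeal (k : Type*) {K : Type*} [Field k] [Field K] [Algebra k K] {n : ℕ}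
    (Y : Set (Projectivization K (Fin n → K))) : Ideal (MvPolynomial (Fin n) k) :=
  Ideal.span {G | (∃ e, G.IsHomogeneous e) ∧ ∀ p ∈ Y, VanishesAt G p}

end Geometry

section Lift

variable {k : Type*} [Field k]

/-- `θ : S → k[x₀, x₁, x₂]`, `θ(x_ij) = x_i x_j`. -/
noncomputable def theta (k : Type*) [Field k] : S k →ₐ[k] MvPolynomial (Fin 3) k :=
  aeval (veroneseVec (fun i => (X i : MvPolynomial (Fin 3) k)))

/-- The monomial of `S` that lifts `x₀ⁱ x₁ʲ x₂ᵏ`, `i + j + k` even, according to the parities of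
`i`, `j`, `k`. -/
noncomputable def liftMonomial (k : Type*) [Field k] (e : Fin 3 →₀ ℕ) : S k :=
  X 0 ^ (e 0 / 2) * X 3 ^ (e 1 / 2) * X 5 ^ (e 2 / 2) *
    (if Odd (e 1) ∧ Odd (e 2) then X 4
     else if Odd (e 0) ∧ Odd (e 2) then X 2
     else if Odd (e 0) ∧ Odd (e 1) then X 1
     else 1)

/-- The explicit lift `F = F^I + F^II + F^III + F^IV` of a form `f` of even degree. -/
noncomputable def evenLift (f : MvPolynomial (Fin 3) k) : S k :=
  ∑ e ∈ f.support, C (coeff e f) * liftMonomial k e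

end Lift

section Complexes

/-- Multiplication by `p` is a degree-preserving homomorphism `S(-b) → S(-a)`: either `p = 0`, or
`b ≥ a` and `p` is a form of degree `b - a`. -/
def IsForm {k : Type*} [Field k] (a b : ℕ) (p : S k) : Prop :=
  p = 0 ∨ ∃ e, a + e = b ∧ p.IsHomogeneous e

theorem isForm_smul_one {k : Type*} [Field k] {ι : Type} [DecidableEq ι] {m : ℕ} (s t : ι → ℕ)
    (h : ∀ i, s i + m = t i) {F : S k} (hF : F.IsHomogeneous m) (i j : ι) :
    IsForm (s i) (t j) ((F • (1 : Matrix ι ι (S k))) i j) := by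
  by_cases hij : i = j
  · subst hij
    exact Or.inr ⟨m, h i, by simpa using hF⟩
  · exact Or.inl (by simp [Matrix.one_apply_ne hij])

/-- A complex `⋯ → E₂ → E₁ → E₀` of graded free `S`-modules of finite rank with homomorphisms of
degree `0`, written in homogeneous bases: `E_i = ⨁_{a : ι i} S(-tw i a)`, and the differential
`E_{i+1} → E_i` is multiplication of column vectors by the matrix `d i` of homogeneous forms. -/
structure GradedFreeComplex (k : Type*) [Field k] where
  ι : ℕ → Type
  fin : ∀ i, Fintype (ι i)
  dec : ∀ i, DecidableEq (ι i)
  tw : ∀ i, ι i → ℕ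
  d : ∀ i, Matrix (ι i) (ι (i + 1)) (S k)
  d_form : ∀ i a b, IsForm (tw i a) (tw (i + 1) b) (d i a b)
  d_comp_d : ∀ i, d i * d (i + 1) = 0

attribute [instance] GradedFreeComplex.fin GradedFreeComplex.dec

variable {k : Type*} [Field k]

/-- A morphism of graded complexes: degree-preserving homomorphisms, written as matrices, that
commute with the differentials. -/
structure GradedHom (A B : GradedFreeComplex k) where
  f : ∀ i, Matrix (B.ι i) (A.ι i) (S k)
  f_form : ∀ i b a, IsForm (B.tw i b) (A.tw i a) (f i b a)
  comm : ∀ i, B.d i * f (i + 1) = f i * A.d i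

/-- An isomorphism of graded complexes. -/
structure GradedIso (A B : GradedFreeComplex k) where
  hom : GradedHom A B
  inv : GradedHom B A
  inv_mul_hom : ∀ i, inv.f i * hom.f i = 1
  hom_mul_inv : ∀ i, hom.f i * inv.f i = 1

/-- The twist `A(-m)` of a complex. -/
def GradedFreeComplex.twist (A : GradedFreeComplex k) (m : ℕ) : GradedFreeComplex k where
  ι := A.ι
  fin := A.fin
  dec := A.dec
  tw i a := A.tw i a + m
  d := A.d
  d_form i a b := by
    rcases A.d_form i a b with h | ⟨e, he, h⟩
    · exact Or.inl h
    · exact Or.inr ⟨e, by omega, h⟩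
  d_comp_d := A.d_comp_d

/-- Multiplication by a form `F` of degree `m`, as a morphism `A(-m) → A`. -/
noncomputable def mulHom (A : GradedFreeComplex k) {m : ℕ} (F : S k) (hF : F.IsHomogeneous m) :
    GradedHom (A.twist m) A where
  f i := F • (1 : Matrix (A.ι i) (A.ι i) (S k))
  f_form i b a := isForm_smul_one (ι := A.ι i) (A.tw i) (fun a => A.tw i a + m) (fun _ => rfl) hF b a
  comm i := by
    change A.d i * (F • (1 : Matrix (A.ι (i + 1)) (A.ι (i + 1)) (S k)))
      = (F • (1 : Matrix (A.ι i) (A.ι i) (S k))) * A.d i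
    simp

/-- The bases of the mapping cone of a morphism `A → B`: `B₀` in degree `0` and `B_{i+1} ⊕ A_i` in
degree `i + 1`. -/
def coneIdx (A B : GradedFreeComplex k) : ℕ → Type
  | 0 => B.ι 0
  | i + 1 => B.ι (i + 1) ⊕ A.ι i

/-- The twists in the mapping cone. -/
def coneTw (A B : GradedFreeComplex k) : ∀ i, coneIdx A B i → ℕ
  | 0 => B.tw 0
  | i + 1 => Sum.elim (B.tw (i + 1)) (A.tw i)

/-- The differential `(b, a) ↦ (d b + φ a, - d a)` of the mapping cone of `φ`. -/
noncomputable def coneD {A B : GradedFreeComplex k} (φ : GradedHom A B) :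
    ∀ i, Matrix (coneIdx A B i) (coneIdx A B (i + 1)) (S k)
  | 0 => Matrix.fromCols (B.d 0) (φ.f 0)
  | i + 1 => Matrix.fromBlocks (B.d (i + 1)) (φ.f (i + 1)) 0 (-(A.d i))

/-- The finiteness of the bases of the mapping cone. -/
instance coneFin (A B : GradedFreeComplex k) : ∀ i, Fintype (coneIdx A B i)
  | 0 => inferInstanceAs (Fintype (B.ι 0))
  | i + 1 => inferInstanceAs (Fintype (B.ι (i + 1) ⊕ A.ι i))

/-- Decidable equality on the bases of the mapping cone. -/
instance coneDec (A B : GradedFreeComplex k) : ∀ i, DecidableEq (coneIdx A B i)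
  | 0 => inferInstanceAs (DecidableEq (B.ι 0))
  | i + 1 => inferInstanceAs (DecidableEq (B.ι (i + 1) ⊕ A.ι i))

/-- The mapping cone of a morphism `φ : A → B` of graded complexes. -/
noncomputable def mappingCone {A B : GradedFreeComplex k} (φ : GradedHom A B) : GradedFreeComplex k where
  ι := coneIdx A B
  fin := coneFin A B
  dec := coneDec A B
  tw := coneTw A B
  d := coneD φ
  d_form i := match i with
    | 0 => by
      rintro a (b | b)
      · exact B.d_form 0 a b
      · exact φ.f_form 0 a b
    | i + 1 => by
      rintro (a | a) (b | b)
      · exact B.d_form (i + 1) a b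
      · exact φ.f_form (i + 1) a b
      · exact Or.inl rfl
      · rcases A.d_form i a b with h | ⟨e, he, h⟩
        · exact Or.inl (show -(A.d i a b) = 0 by rw [h, neg_zero])
        · exact Or.inr ⟨e, he, show (-(A.d i a b)).IsHomogeneous e from h.neg⟩
  d_comp_d i := match i with
    | 0 => by
      change Matrix.fromCols (B.d 0) (φ.f 0) *
        Matrix.fromBlocks (B.d 1) (φ.f 1) 0 (-(A.d 0)) = 0
      rw [Matrix.fromCols_mul_fromBlocks, B.d_comp_d, φ.comm 0]
      simp
    | i + 1 => by
      change Matrix.fromBlocks (B.d (i + 1)) (φ.f (i + 1)) 0 (-(A.d i)) *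
        Matrix.fromBlocks (B.d (i + 2)) (φ.f (i + 2)) 0 (-(A.d (i + 1))) = 0
      rw [Matrix.fromBlocks_multiply, B.d_comp_d, φ.comm (i + 1)]
      simp [A.d_comp_d]

/-- The complex `⋯ → E₁ → E₀` together with `ε : E₀ → M` is a minimal free resolution
`⋯ → E₂ → E₁ → E₀ → M → 0` of `M`: the sequence is exact, and no matrix entry has a nonzero
constant term. -/
structure IsMinimalFreeResolution (A : GradedFreeComplex k) {M : Type*} [AddCommGroup M]
    [Module (S k) M] (ε : (A.ι 0 → S k) →ₗ[S k] M) : Prop where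
  surjective : Function.Surjective ε
  exact_zero : Function.Exact (A.d 0).mulVecLin ε
  exact_succ : ∀ i, Function.Exact (A.d (i + 1)).mulVecLin (A.d i).mulVecLin
  minimal : ∀ i a b, constantCoeff (A.d i a b) = 0

/-- The quotient map `S → S/I`, on `S` written as the free module with basis `Fin 1`. -/
noncomputable def augmentation (I : Ideal (S k)) : (Fin 1 → S k) →ₗ[S k] S k ⧸ I :=
  I.mkQ ∘ₗ LinearMap.proj 0

end Complexes

section Resolutions

variable (k : Type*) [Field k]

/-- The minors `Δ₀₀, Δ₀₁, Δ₀₂, Δ₁₁, Δ₁₂, Δ₂₂` of the symmetric matrix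
`[x₀₀ x₀₁ x₀₂; x₀₁ x₁₁ x₁₂; x₀₂ x₁₂ x₂₂]`. -/
noncomputable def minors : Fin 6 → S k :=
  let x00 : S k := X 0
  let x01 : S k := X 1
  let x02 : S k := X 2
  let x11 : S k := X 3
  let x12 : S k := X 4
  let x22 : S k := X 5
  ![x11 * x22 - x12 ^ 2, x01 * x22 - x12 * x02, x01 * x12 - x02 * x11,
    x00 * x22 - x02 ^ 2, x00 * x12 - x02 * x01, x00 * x11 - x01 ^ 2]

/-- The row matrix `M₁`. -/
noncomputable def M₁ : Matrix (Fin 1) (Fin 6) (S k) :=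
  Matrix.of ![minors k]

/-- The matrix `M₂`. -/
noncomputable def M₂ : Matrix (Fin 6) (Fin 8) (S k) :=
  let x00 : S k := X 0
  let x01 : S k := X 1
  let x02 : S k := X 2
  let x11 : S k := X 3
  let x12 : S k := X 4
  let x22 : S k := X 5
  !![x02, 0, x01, 0, 0, x00, 0, 0;
    -x12, x02, -x11, x01, 0, 0, x00, 0;
    x22, 0, x12, x02, x01, x02, 0, x00;
    0, -x12, 0, -x11, 0, -x11, -x01, 0;
    0, x22, 0, 0, -x11, x12, x02, -x01;
    0, 0, 0, x22, x12, 0, 0, x02]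

/-- The matrix `M₃`. -/
noncomputable def M₃ : Matrix (Fin 8) (Fin 3) (S k) :=
  let x00 : S k := X 0
  let x01 : S k := X 1
  let x02 : S k := X 2
  let x11 : S k := X 3
  let x12 : S k := X 4
  let x22 : S k := X 5
  !![x01, x00, 0;
    -x11, -x01, 0;
    -x02, 0, x00;
    x12, x02, 0;
    -x22, 0, x02;
    0, -x02, -x01;
    0, x12, x11;
    0, -x22, -x12]

theorem M₁_mul_M₂ : M₁ k * M₂ k = 0 := by
  ext1 i j
  fin_cases i
  fin_cases j <;>
    simp [M₁, M₂, minors, Matrix.mul_apply, Fin.sum_univ_succ] <;> ring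

theorem M₂_mul_M₃ : M₂ k * M₃ k = 0 := by
  ext1 i j
  fin_cases i <;> fin_cases j <;>
    simp [M₂, M₃, Matrix.mul_apply, Fin.sum_univ_succ] <;> ring

theorem isHomogeneous_minors (i : Fin 6) : (minors k i).IsHomogeneous 2 := by
  have hm (a b : Fin 6) : (X a * X b : S k).IsHomogeneous 2 :=
    (isHomogeneous_X k a).mul (isHomogeneous_X k b)
  have hp (a : Fin 6) : (X a ^ 2 : S k).IsHomogeneous 2 := isHomogeneous_X_pow a 2
  fin_cases i
  · exact (hm 3 5).sub (hp 4)
  · exact (hm 1 5).sub (hm 4 2)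
  · exact (hm 1 4).sub (hm 2 3)
  · exact (hm 0 5).sub (hp 2)
  · exact (hm 0 4).sub (hm 2 1)
  · exact (hm 0 3).sub (hp 1)

theorem isHomogeneous_M₁ (i : Fin 1) (j : Fin 6) : (M₁ k i j).IsHomogeneous 2 := by
  fin_cases i
  exact isHomogeneous_minors k j

theorem isHomogeneous_M₂ (i : Fin 6) (j : Fin 8) : (M₂ k i j).IsHomogeneous 1 := by
  have h0 : (0 : S k).IsHomogeneous 1 := isHomogeneous_zero _ _ _
  have hx (a : Fin 6) : (X a : S k).IsHomogeneous 1 := isHomogeneous_X k a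
  have hn (a : Fin 6) : (-X a : S k).IsHomogeneous 1 := (isHomogeneous_X k a).neg
  fin_cases i <;> fin_cases j <;> first | exact h0 | exact hx _ | exact hn _

theorem isHomogeneous_M₃ (i : Fin 8) (j : Fin 3) : (M₃ k i j).IsHomogeneous 1 := by
  have h0 : (0 : S k).IsHomogeneous 1 := isHomogeneous_zero _ _ _
  have hx (a : Fin 6) : (X a : S k).IsHomogeneous 1 := isHomogeneous_X k a
  have hn (a : Fin 6) : (-X a : S k).IsHomogeneous 1 := (isHomogeneous_X k a).neg
  fin_cases i <;> fin_cases j <;> first | exact h0 | exact hx _ | exact hn _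

/-- The bases of `0 → S(-4)³ → S(-3)⁸ → S(-2)⁶ → S`. -/
def veroneseIdx : ℕ → Type
  | 0 => Fin 1
  | 1 => Fin 6
  | 2 => Fin 8
  | 3 => Fin 3
  | _ + 4 => Empty

/-- The twists in `0 → S(-4)³ → S(-3)⁸ → S(-2)⁶ → S`. -/
def veroneseTw : ∀ i, veroneseIdx i → ℕ
  | 0 => fun _ => 0
  | 1 => fun _ => 2
  | 2 => fun _ => 3
  | 3 => fun _ => 4
  | _ + 4 => Empty.elim

/-- The matrices `M₁`, `M₂`, `M₃`, followed by zeros. -/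
noncomputable def veroneseD : ∀ i, Matrix (veroneseIdx i) (veroneseIdx (i + 1)) (S k)
  | 0 => M₁ k
  | 1 => M₂ k
  | 2 => M₃ k
  | _ + 3 => 0

/-- The finiteness of the bases. -/
instance veroneseFin : ∀ i, Fintype (veroneseIdx i)
  | 0 => inferInstanceAs (Fintype (Fin 1))
  | 1 => inferInstanceAs (Fintype (Fin 6))
  | 2 => inferInstanceAs (Fintype (Fin 8))
  | 3 => inferInstanceAs (Fintype (Fin 3))
  | _ + 4 => inferInstanceAs (Fintype Empty)

/-- Decidable equality on the bases. -/
instance veroneseDec : ∀ i, DecidableEq (veroneseIdx i)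
  | 0 => inferInstanceAs (DecidableEq (Fin 1))
  | 1 => inferInstanceAs (DecidableEq (Fin 6))
  | 2 => inferInstanceAs (DecidableEq (Fin 8))
  | 3 => inferInstanceAs (DecidableEq (Fin 3))
  | _ + 4 => inferInstanceAs (DecidableEq Empty)

/-- The complex `0 → S(-4)³ → S(-3)⁸ → S(-2)⁶ → S` with the matrices `M₃`, `M₂`, `M₁`. -/
noncomputable def veroneseComplex : GradedFreeComplex k where
  ι := veroneseIdx
  fin := veroneseFin
  dec := veroneseDec
  tw := veroneseTw
  d := veroneseD k
  d_form i a b := match i, a, b with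
    | 0, a, b => Or.inr ⟨2, rfl, isHomogeneous_M₁ k a b⟩
    | 1, a, b => Or.inr ⟨1, rfl, isHomogeneous_M₂ k a b⟩
    | 2, a, b => Or.inr ⟨1, rfl, isHomogeneous_M₃ k a b⟩
    | _ + 3, _, _ => Or.inl rfl
  d_comp_d i := match i with
    | 0 => M₁_mul_M₂ k
    | 1 => M₂_mul_M₃ k
    | 2 => Matrix.mul_zero (M₃ k)
    | i + 3 => Matrix.mul_zero (0 : Matrix (veroneseIdx (i + 3)) (veroneseIdx (i + 4)) (S k))

/-- The bases of
`0 → S(-m-4)³ → S(-4)³ ⊕ S(-m-3)⁸ → S(-3)⁸ ⊕ S(-m-2)⁶ → S(-2)⁶ ⊕ S(-m) → S`. -/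
def curveIdx : ℕ → Type
  | 0 => Fin 1
  | 1 => Fin 6 ⊕ Fin 1
  | 2 => Fin 8 ⊕ Fin 6
  | 3 => Fin 3 ⊕ Fin 8
  | 4 => Fin 3
  | _ + 5 => Empty

/-- The twists in
`0 → S(-m-4)³ → S(-4)³ ⊕ S(-m-3)⁸ → S(-3)⁸ ⊕ S(-m-2)⁶ → S(-2)⁶ ⊕ S(-m) → S`. -/
def curveTw (m : ℕ) : ∀ i, curveIdx i → ℕ
  | 0 => fun _ => 0
  | 1 => Sum.elim (fun _ => 2) (fun _ => m)
  | 2 => Sum.elim (fun _ => 3) (fun _ => m + 2)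
  | 3 => Sum.elim (fun _ => 4) (fun _ => m + 3)
  | 4 => fun _ => m + 4
  | _ + 5 => Empty.elim

variable {k}

/-- `M₁' = [M₁, F]`. -/
noncomputable def M₁' (F : S k) : Matrix (Fin 1) (Fin 6 ⊕ Fin 1) (S k) :=
  Matrix.fromCols (M₁ k) (F • (1 : Matrix (Fin 1) (Fin 1) (S k)))

/-- `M₂' = [M₂, -F I₆; 0, M₁]`. -/
noncomputable def M₂' (F : S k) : Matrix (Fin 6 ⊕ Fin 1) (Fin 8 ⊕ Fin 6) (S k) :=
  Matrix.fromBlocks (M₂ k) (-F • (1 : Matrix (Fin 6) (Fin 6) (S k))) 0 (M₁ k)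

/-- `M₃' = [M₃, F I₈; 0, M₂]`. -/
noncomputable def M₃' (F : S k) : Matrix (Fin 8 ⊕ Fin 6) (Fin 3 ⊕ Fin 8) (S k) :=
  Matrix.fromBlocks (M₃ k) (F • (1 : Matrix (Fin 8) (Fin 8) (S k))) 0 (M₂ k)

/-- `M₄' = [-F I₃; M₃]`. -/
noncomputable def M₄' (F : S k) : Matrix (Fin 3 ⊕ Fin 8) (Fin 3) (S k) :=
  Matrix.fromRows (-F • (1 : Matrix (Fin 3) (Fin 3) (S k))) (M₃ k)

/-- The matrices `M₁'`, `M₂'`, `M₃'`, `M₄'`, followed by zeros. -/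
noncomputable def curveD (F : S k) : ∀ i, Matrix (curveIdx i) (curveIdx (i + 1)) (S k)
  | 0 => M₁' F
  | 1 => M₂' F
  | 2 => M₃' F
  | 3 => M₄' F
  | _ + 4 => 0

/-- The finiteness of the bases. -/
instance curveFin : ∀ i, Fintype (curveIdx i)
  | 0 => inferInstanceAs (Fintype (Fin 1))
  | 1 => inferInstanceAs (Fintype (Fin 6 ⊕ Fin 1))
  | 2 => inferInstanceAs (Fintype (Fin 8 ⊕ Fin 6))
  | 3 => inferInstanceAs (Fintype (Fin 3 ⊕ Fin 8))
  | 4 => inferInstanceAs (Fintype (Fin 3))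
  | _ + 5 => inferInstanceAs (Fintype Empty)

/-- Decidable equality on the bases. -/
instance curveDec : ∀ i, DecidableEq (curveIdx i)
  | 0 => inferInstanceAs (DecidableEq (Fin 1))
  | 1 => inferInstanceAs (DecidableEq (Fin 6 ⊕ Fin 1))
  | 2 => inferInstanceAs (DecidableEq (Fin 8 ⊕ Fin 6))
  | 3 => inferInstanceAs (DecidableEq (Fin 3 ⊕ Fin 8))
  | 4 => inferInstanceAs (DecidableEq (Fin 3))
  | _ + 5 => inferInstanceAs (DecidableEq Empty)

theorem M₁'_mul_M₂' (F : S k) : M₁' F * M₂' F = 0 := by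
  rw [M₁', M₂', Matrix.fromCols_mul_fromBlocks, M₁_mul_M₂]
  simp

theorem M₂'_mul_M₃' (F : S k) : M₂' F * M₃' F = 0 := by
  rw [M₂', M₃', Matrix.fromBlocks_multiply, M₁_mul_M₂, M₂_mul_M₃]
  simp

theorem M₃'_mul_M₄' (F : S k) : M₃' F * M₄' F = 0 := by
  rw [M₃', M₄', Matrix.fromBlocks_mul_fromRows, M₂_mul_M₃]
  simp

/-- The complex
`0 → S(-m-4)³ → S(-4)³ ⊕ S(-m-3)⁸ → S(-3)⁸ ⊕ S(-m-2)⁶ → S(-2)⁶ ⊕ S(-m) → S`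
with the matrices `M₄'`, `M₃'`, `M₂'`, `M₁'`. -/
noncomputable def curveComplex {m : ℕ} (F : S k) (hF : F.IsHomogeneous m) :
    GradedFreeComplex k where
  ι := curveIdx
  fin := curveFin
  dec := curveDec
  tw := curveTw m
  d := curveD F
  d_form i a b := match i, a, b with
    | 0, a, Sum.inl b => Or.inr ⟨2, rfl, isHomogeneous_M₁ k a b⟩
    | 0, a, Sum.inr b => isForm_smul_one (fun _ : Fin 1 => 0) (fun _ => m) (fun _ => Nat.zero_add m) hF a b
    | 1, Sum.inl a, Sum.inl b => Or.inr ⟨1, rfl, isHomogeneous_M₂ k a b⟩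
    | 1, Sum.inl a, Sum.inr b => isForm_smul_one (fun _ : Fin 6 => 2) (fun _ => m + 2) (fun _ => Nat.add_comm 2 m) hF.neg a b
    | 1, Sum.inr _, Sum.inl _ => Or.inl rfl
    | 1, Sum.inr a, Sum.inr b => Or.inr ⟨2, rfl, isHomogeneous_M₁ k a b⟩
    | 2, Sum.inl a, Sum.inl b => Or.inr ⟨1, rfl, isHomogeneous_M₃ k a b⟩
    | 2, Sum.inl a, Sum.inr b => isForm_smul_one (fun _ : Fin 8 => 3) (fun _ => m + 3) (fun _ => Nat.add_comm 3 m) hF a b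
    | 2, Sum.inr _, Sum.inl _ => Or.inl rfl
    | 2, Sum.inr a, Sum.inr b => Or.inr ⟨1, rfl, isHomogeneous_M₂ k a b⟩
    | 3, Sum.inl a, b => isForm_smul_one (fun _ : Fin 3 => 4) (fun _ => m + 4) (fun _ => Nat.add_comm 4 m) hF.neg a b
    | 3, Sum.inr a, b => Or.inr ⟨1, rfl, isHomogeneous_M₃ k a b⟩
    | _ + 4, _, _ => Or.inl rfl
  d_comp_d i := match i with
    | 0 => M₁'_mul_M₂' F
    | 1 => M₂'_mul_M₃' F
    | 2 => M₃'_mul_M₄' F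
    | 3 => Matrix.mul_zero (M₄' F)
    | i + 4 => Matrix.mul_zero (0 : Matrix (curveIdx (i + 4)) (curveIdx (i + 5)) (S k))

end Resolutions

end VeroneseCurve

/-! The surface comes first. `theta` sends monomials to monomials, and modulo the minors every
monomial of `S` is congruent to a scalar multiple of the chosen lift of its image
(`sub_linearLift_theta_mem`). So the minors generate the kernel of `theta` (`theta_eq_zero_iff`),
and `S` modulo the minors is a domain, being a subring of `k[x₀, x₁, x₂]`. The Nullstellensatz
identifies this kernel with the ideal of the surface (`homogeneousIdeal_veronese`).

Exactness of `V` comes from division with respect to the single variable `X 4 = x₁₂`. Up to signs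
and the order of the columns, suitable square submatrices of `M₂` and `M₃` have the form `X 4 • 1 +
N` with `N` free of `X 4`, so vectors can be divided by them with a remainder free of `X 4`
(`monic_div`), and a nonzero multiple is never free of `X 4` (`monic_kernel`). Subtracting a
boundary thus makes chosen entries of a cycle free of `X 4`; such cycles are then solved by hand
(`M₁_kernel`, `M₂_kernel`).

For the curve, a form `G` vanishing on `σ(C)` has `theta k G` divisible by `f`, because `(f)` is
prime. The cofactor has even degree, hence lifts to `S`, and `G` is a multiple of `F` modulo the
minors (`homogeneousIdeal_curve`). Since `theta k F = f ≠ 0`, `F` is a nonzerodivisor modulo the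
minors; this is what exactness of the mapping cone requires (`curve_resolution`). The stated complex
is the cone up to signs (`curveIsoCone`). -/

namespace VeroneseCurve

/-! ### Division and syzygies with respect to one variable -/

section OneVariable

variable {k : Type*} [Field k]

/-- A polynomial of `S`, viewed as a polynomial in the variable `X n`. -/
noncomputable def viewPoly (n : Fin 6) : S k →ₐ[k] Polynomial (S k) :=
  aeval fun i => if i = n then Polynomial.X else Polynomial.C (X i)

theorem viewPoly_X_self (n : Fin 6) : viewPoly n (X n : S k) = Polynomial.X := by
  simp [viewPoly]

theorem viewPoly_X_of_ne {i n : Fin 6} (h : i ≠ n) :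
    viewPoly n (X i : S k) = Polynomial.C (X i) := by
  simp [viewPoly, h]

theorem eval_viewPoly (n : Fin 6) (p : S k) : (viewPoly n p).eval (X n) = p := by
  induction p using MvPolynomial.induction_on with
  | C a =>
    rw [← algebraMap_eq, AlgHom.commutes, Polynomial.algebraMap_apply, Polynomial.eval_C]
  | add p q hp hq => rw [map_add, Polynomial.eval_add, hp, hq]
  | mul_X p i hp =>
    rw [map_mul, Polynomial.eval_mul, hp]
    by_cases h : i = n
    · rw [h, viewPoly_X_self, Polynomial.eval_X]
    · rw [viewPoly_X_of_ne h, Polynomial.eval_C]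

theorem viewPoly_injective (n : Fin 6) : Function.Injective (viewPoly n : S k →ₐ[k] _) := by
  intro p q h
  rw [← eval_viewPoly n p, h, eval_viewPoly]

variable (k) in
/-- The polynomials that do not involve `X n`. -/
noncomputable def freeOf (n : Fin 6) : Subalgebra k (S k) :=
  AlgHom.equalizer (viewPoly n) Polynomial.CAlgHom

theorem mem_freeOf {n : Fin 6} {p : S k} : p ∈ freeOf k n ↔ viewPoly n p = Polynomial.C p :=
  Iff.rfl

theorem X_mem_freeOf {i n : Fin 6} (h : i ≠ n) : (X i : S k) ∈ freeOf k n :=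
  viewPoly_X_of_ne h

/-- Uniqueness of division by the matrix `X n • 1 + N`, which is monic in `X n`. The coefficient of
degree `d + 1` in the hypothesis expresses the degree `d` coefficients of `u` through those of
degree `d + 1`; these vanish for large `d`, so descending induction kills them all. -/
theorem monic_kernel {n : Fin 6} {ι : Type*} [Fintype ι] {N : Matrix ι ι (S k)}
    (hN : ∀ i j, N i j ∈ freeOf k n) {u : ι → S k}
    (h : ∀ i, X n * u i + ∑ j, N i j * u j ∈ freeOf k n) : u = 0 := by
  have key (i : ι) (d : ℕ) : (viewPoly n (u i)).coeff d
      = -∑ j, N i j * (viewPoly n (u j)).coeff (d + 1) := by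
    have h1 := mem_freeOf.1 (h i)
    rw [map_add, map_mul, map_sum, viewPoly_X_self] at h1
    have h2 := congrArg (fun P => Polynomial.coeff P (d + 1)) h1
    simp only [Polynomial.coeff_add, Polynomial.coeff_X_mul, Polynomial.finsetSum_coeff,
      Polynomial.coeff_C_succ] at h2
    rw [eq_neg_iff_add_eq_zero]
    refine Eq.trans (congrArg _ (Finset.sum_congr rfl fun j _ => ?_)) h2
    rw [map_mul, mem_freeOf.1 (hN i j), Polynomial.coeff_C_mul]
  have bound : ∃ D, ∀ i d, D ≤ d → (viewPoly n (u i)).coeff d = 0 := by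
    refine ⟨(∑ i, (viewPoly n (u i)).natDegree) + 1, fun i d hd => ?_⟩
    apply Polynomial.coeff_eq_zero_of_natDegree_lt
    have := Finset.single_le_sum (f := fun i => (viewPoly n (u i)).natDegree)
      (fun _ _ => Nat.zero_le _) (Finset.mem_univ i)
    omega
  obtain ⟨D, hD⟩ := bound
  have all (e : ℕ) : ∀ d, D ≤ d + e → ∀ i, (viewPoly n (u i)).coeff d = 0 := by
    induction e with
    | zero => exact fun d hd i => hD i d hd
    | succ e ih =>
      intro d hd i
      rw [key, Finset.sum_eq_zero, neg_zero]
      exact fun j _ => by rw [ih (d + 1) (by omega), mul_zero]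
  funext i
  apply viewPoly_injective n
  ext1 d
  rw [all D d (by omega) i, Pi.zero_apply, map_zero, Polynomial.coeff_zero]

/-- The divisible vectors form an `S`-submodule containing the vectors free of `X n`, hence are all
vectors. Only stability under `X n` needs the matrix. -/
theorem monic_div {n : Fin 6} {ι : Type*} [Fintype ι] {N : Matrix ι ι (S k)}
    (hN : ∀ i j, N i j ∈ freeOf k n) (v : ι → S k) :
    ∃ u w : ι → S k, (∀ i, w i ∈ freeOf k n) ∧
      ∀ i, v i = X n * u i + ∑ j, N i j * u j + w i := by
  classical
  let D (v : ι → S k) : Prop := ∃ u w : ι → S k, (∀ i, w i ∈ freeOf k n) ∧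
      ∀ i, v i = X n * u i + ∑ j, N i j * u j + w i
  have hadd {v v' : ι → S k} : D v → D v' → D (v + v') := by
    rintro ⟨u, w, hw, h⟩ ⟨u', w', hw', h'⟩
    refine ⟨u + u', w + w', fun i => add_mem (hw i) (hw' i), fun i => ?_⟩
    simp only [Pi.add_apply, h i, h' i, mul_add, Finset.sum_add_distrib]
    ring
  have hfree {p : S k} (hp : p ∈ freeOf k n) {v : ι → S k} : D v → D (p • v) := by
    rintro ⟨u, w, hw, h⟩
    refine ⟨p • u, p • w, fun i => mul_mem hp (hw i), fun i => ?_⟩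
    simp only [Pi.smul_apply, smul_eq_mul, h i, mul_add, Finset.mul_sum]
    congr 2
    · ring
    · exact Finset.sum_congr rfl fun j _ => by ring
  -- The new remainder `X n • w` is divided once more: it equals `(X n • 1 + N) w - N w`, and `N w`
  -- is free of `X n`.
  have hX {v : ι → S k} : D v → D ((X n : S k) • v) := by
    rintro ⟨u, w, hw, h⟩
    refine ⟨(X n : S k) • u + w, fun i => -∑ j, N i j * w j,
      fun i => neg_mem (sum_mem fun j _ => mul_mem (hN i j) (hw j)), fun i => ?_⟩
    simp only [Pi.smul_apply, Pi.add_apply, smul_eq_mul, h i, mul_add, Finset.mul_sum,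
      Finset.sum_add_distrib]
    have : ∑ j, X n * (N i j * u j) = ∑ j, N i j * (X n * u j) :=
      Finset.sum_congr rfl fun j _ => by ring
    rw [this]
    ring
  have hmul (p : S k) : ∀ {v : ι → S k}, D v → D (p • v) := by
    induction p using MvPolynomial.induction_on with
    | C a => exact fun h => hfree ((freeOf k n).algebraMap_mem a) h
    | add p q hp hq => exact fun h => by rw [add_smul]; exact hadd (hp h) (hq h)
    | mul_X p i hp =>
      intro v h
      rw [mul_smul]
      by_cases hi : i = n
      · exact hp (hi ▸ hX h)
      · exact hp (hfree (X_mem_freeOf hi) h)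
  have hw {w : ι → S k} (hw : ∀ i, w i ∈ freeOf k n) : D w := ⟨0, w, hw, fun i => by simp⟩
  have hv : v = ∑ i, v i • (Pi.single i 1 : ι → S k) := by
    funext j
    simp [Finset.sum_apply, Pi.single_apply]
  change D v
  rw [hv]
  refine Finset.sum_induction _ D (fun _ _ => hadd) (hw fun _ => zero_mem _) fun i _ => ?_
  refine hmul _ (hw fun j => ?_)
  by_cases hj : j = i
  · subst hj; simp [one_mem]
  · simp [hj, zero_mem]

/-- Uniqueness of quotient and remainder for the monic quadratic `X n ^ 2 - q`, reduced to the
linear case by a companion matrix. -/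
theorem quadratic_kernel {n : Fin 6} {q u w₀ w₁ : S k} (hq : q ∈ freeOf k n)
    (h₀ : w₀ ∈ freeOf k n) (h₁ : w₁ ∈ freeOf k n)
    (h : (X n ^ 2 - q) * u = w₀ + X n * w₁) : u = 0 ∧ w₀ = 0 ∧ w₁ = 0 := by
  have hu : u = 0 := by
    have hN : ∀ i j, (!![0, -q; -1, 0] : Matrix (Fin 2) (Fin 2) (S k)) i j ∈ freeOf k n := by
      intro i j
      fin_cases i <;> fin_cases j <;> simp [zero_mem, one_mem, hq]
    -- With this vector the two rows of `X n • 1 + N` evaluate to `w₀` and `w₁`.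
    have := monic_kernel hN (u := ![X n * u - w₁, u]) (by
      intro i
      fin_cases i
      · simp only [Fin.sum_univ_two]
        simp only [Fin.zero_eta, Matrix.cons_val_zero, Matrix.of_apply, Matrix.cons_val_one,
          Matrix.cons_val_fin_one]
        convert h₀ using 1
        linear_combination h
      · simp only [Fin.sum_univ_two]
        simp only [Fin.mk_one, Matrix.cons_val_zero, Matrix.of_apply, Matrix.cons_val_one,
          Matrix.cons_val_fin_one]
        convert h₁ using 1
        ring)
    exact congrFun this 1
  subst hu
  rw [mul_zero] at h
  have h2 := congrArg (viewPoly n) h.symm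
  rw [map_add, map_mul, viewPoly_X_self, mem_freeOf.1 h₀, mem_freeOf.1 h₁, map_zero] at h2
  have c0 := congrArg (fun P => Polynomial.coeff P 0) h2
  have c1 := congrArg (fun P => Polynomial.coeff P 1) h2
  simp [Polynomial.coeff_C] at c0 c1
  exact ⟨rfl, c0, c1⟩

theorem quadratic_div {n : Fin 6} {q : S k} (hq : q ∈ freeOf k n) (v : S k) :
    ∃ u w₀ w₁ : S k, w₀ ∈ freeOf k n ∧ w₁ ∈ freeOf k n ∧
      v = (X n ^ 2 - q) * u + w₀ + X n * w₁ := by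
  induction v using MvPolynomial.induction_on with
  | C a => exact ⟨0, C a, 0, (freeOf k n).algebraMap_mem a, zero_mem _, by ring⟩
  | add v v' h h' =>
    obtain ⟨u, w₀, w₁, h₀, h₁, rfl⟩ := h
    obtain ⟨u', w₀', w₁', h₀', h₁', rfl⟩ := h'
    exact ⟨u + u', w₀ + w₀', w₁ + w₁', add_mem h₀ h₀', add_mem h₁ h₁', by ring⟩
  | mul_X v i h =>
    obtain ⟨u, w₀, w₁, h₀, h₁, rfl⟩ := h
    by_cases hi : i = n
    · subst hi
      exact ⟨u * X i + w₁, q * w₁, w₀, mul_mem hq h₁, h₀, by ring⟩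
    · have := X_mem_freeOf (k := k) hi
      exact ⟨u * X i, w₀ * X i, w₁ * X i, mul_mem h₀ this, mul_mem h₁ this, by ring⟩

theorem linear_div (n : Fin 6) (v : S k) :
    ∃ u w : S k, w ∈ freeOf k n ∧ v = X n * u + w := by
  obtain ⟨u, w₀, w₁, h₀, h₁, h⟩ := quadratic_div (zero_mem (freeOf k n)) v
  exact ⟨X n * u + w₁, w₀, h₀, by rw [h]; ring⟩

theorem linear_kernel {n : Fin 6} {u w : S k} (h₀ : w ∈ freeOf k n)
    (h : X n * u = w) : u = 0 := by
  refine (quadratic_kernel (zero_mem (freeOf k n)) (zero_mem _) h₀ (u := u) ?_).1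
  rw [← h]; ring

/-- The syzygies of `X a, X b, X c` are the Koszul ones. -/
theorem koszul_three {a b c : Fin 6} (hab : a ≠ b) (hac : a ≠ c) (hbc : b ≠ c)
    {u v w : S k} (h : X a * u + X b * v + X c * w = 0) :
    ∃ r s t : S k, u = X b * r + X c * s ∧ v = -(X a * r) + X c * t ∧
      w = -(X a * s) - X b * t := by
  obtain ⟨s, u', hu', rfl⟩ := linear_div c u
  obtain ⟨t, v', hv', rfl⟩ := linear_div c v
  have h1 : w + X a * s + X b * t = 0 := by
    refine linear_kernel (n := c) (w := -(X a * u' + X b * v')) ?_ (by linear_combination h)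
    exact neg_mem (add_mem (mul_mem (X_mem_freeOf hac) hu') (mul_mem (X_mem_freeOf hbc) hv'))
  have h2 : X a * u' + X b * v' = 0 := by linear_combination h - X c * h1
  obtain ⟨r, w', hw', rfl⟩ := linear_div b u'
  have h3 : v' + X a * r = 0 := by
    refine linear_kernel (n := b) (w := -(X a * w')) ?_ (by linear_combination h2)
    exact neg_mem (mul_mem (X_mem_freeOf hab) hw')
  have h4 : w' = 0 := by
    have : X a * w' = 0 := by linear_combination h2 - X b * h3
    exact (mul_eq_zero.1 this).resolve_left (X_ne_zero a)
  subst h4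
  exact ⟨r, s, t, by ring, by linear_combination h3, by linear_combination h1⟩

/-- Divide `w` by `X n ^ 2 - p`. The remainder times `q` is again a multiple of `X n ^ 2 - p` of
degree at most one in `X n`, so it vanishes. -/
theorem quadratic_syzygy {n : Fin 6} {p q v w : S k} (hp : p ∈ freeOf k n)
    (hq : q ∈ freeOf k n) (hq0 : q ≠ 0) (h : (X n ^ 2 - p) * v = q * w) :
    ∃ r, w = (X n ^ 2 - p) * r ∧ v = q * r := by
  obtain ⟨u, w₀, w₁, h₀, h₁, rfl⟩ := quadratic_div hp w
  obtain ⟨h2, h3, h4⟩ := quadratic_kernel hp (mul_mem hq h₀) (mul_mem hq h₁)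
    (u := v - q * u) (by linear_combination h)
  rw [(mul_eq_zero.1 h3).resolve_left hq0, (mul_eq_zero.1 h4).resolve_left hq0]
  exact ⟨u, by ring, by linear_combination h2⟩

end OneVariable

end VeroneseCurve

namespace VeroneseCurve

/-! ### Exactness of the complex of the Veronese surface -/

section Veronese

variable {k : Type*} [Field k]

theorem M₁_mulVec (v : Fin 6 → S k) : (M₁ k).mulVec v = ![
    (X 3 * X 5 - X 4 ^ 2) * v 0 + (X 1 * X 5 - X 4 * X 2) * v 1 + (X 1 * X 4 - X 2 * X 3) * v 2
      + (X 0 * X 5 - X 2 ^ 2) * v 3 + (X 0 * X 4 - X 2 * X 1) * v 4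
      + (X 0 * X 3 - X 1 ^ 2) * v 5] := by
  funext i
  fin_cases i
  simp [M₁, minors, Matrix.mulVec, dotProduct, Fin.sum_univ_succ]
  ring

theorem M₂_mulVec (v : Fin 8 → S k) : (M₂ k).mulVec v = ![
    X 2 * v 0 + X 1 * v 2 + X 0 * v 5,
    -(X 4 * v 0) + X 2 * v 1 - X 3 * v 2 + X 1 * v 3 + X 0 * v 6,
    X 5 * v 0 + X 4 * v 2 + X 2 * v 3 + X 1 * v 4 + X 2 * v 5 + X 0 * v 7,
    -(X 4 * v 1) - X 3 * v 3 - X 3 * v 5 - X 1 * v 6,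
    X 5 * v 1 - X 3 * v 4 + X 4 * v 5 + X 2 * v 6 - X 1 * v 7,
    X 5 * v 3 + X 4 * v 4 + X 2 * v 7] := by
  funext i
  fin_cases i <;> simp [M₂, Matrix.mulVec, dotProduct, Fin.sum_univ_succ] <;> ring

theorem M₃_mulVec (v : Fin 3 → S k) : (M₃ k).mulVec v = ![
    X 1 * v 0 + X 0 * v 1, -(X 3 * v 0) - X 1 * v 1, -(X 2 * v 0) + X 0 * v 2,
    X 4 * v 0 + X 2 * v 1, -(X 5 * v 0) + X 2 * v 2, -(X 2 * v 1) - X 1 * v 2,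
    X 4 * v 1 + X 3 * v 2, -(X 5 * v 1) - X 4 * v 2] := by
  funext i
  fin_cases i <;> simp [M₃, Matrix.mulVec, dotProduct, Fin.sum_univ_succ] <;> ring

/-- The part of `M₃` that reduces the coordinates `3`, `6`, `7` modulo `X 4`. -/
noncomputable def M₃Rest (k : Type*) [Field k] : Matrix (Fin 3) (Fin 3) (S k) :=
  !![0, X 2, 0; 0, 0, X 3; 0, X 5, 0]

theorem M₃Rest_mem (i j : Fin 3) : M₃Rest k i j ∈ freeOf k 4 := by
  fin_cases i <;> fin_cases j <;>
    first | exact zero_mem _ | exact X_mem_freeOf (by decide)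

/-- The part of `M₂` that reduces the coordinates `1`, …, `5` modulo `X 4`. -/
noncomputable def M₂Rest (k : Type*) [Field k] : Matrix (Fin 5) (Fin 5) (S k) :=
  !![0, -X 3, -X 2, 0, 0; -X 5, 0, 0, X 2, X 1; 0, 0, 0, -X 3, 0; 0, 0, -X 5, 0, -X 3; 0, 0, 0, 0, 0]

theorem M₂Rest_mem (i j : Fin 5) : M₂Rest k i j ∈ freeOf k 4 := by
  fin_cases i <;> fin_cases j <;> simp [M₂Rest, zero_mem, X_mem_freeOf]

theorem minor_ne_zero : (X 0 * X 3 - X 1 ^ 2 : S k) ≠ 0 := by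
  intro h
  have := congrArg (aeval (![1, 0, 0, 1, 0, 0] : Fin 6 → k)) h
  simp at this

/-- The upper left 2 × 2 block of `M₃` has determinant `Δ₂₂`, which is nonzero. -/
theorem M₃_kernel {v : Fin 3 → S k} (h : (M₃ k).mulVec v = 0) : v = 0 := by
  rw [M₃_mulVec] at h
  have h0 : X 1 * v 0 + X 0 * v 1 = 0 := congrFun h 0
  have h1 : -(X 3 * v 0) - X 1 * v 1 = 0 := congrFun h 1
  have h2 : -(X 2 * v 0) + X 0 * v 2 = 0 := congrFun h 2
  have e0 : v 0 = 0 := (mul_eq_zero.1 (show (X 0 * X 3 - X 1 ^ 2) * v 0 = 0 by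
    linear_combination -X 0 * h1 - X 1 * h0)).resolve_left minor_ne_zero
  rw [e0] at h0 h2
  have e1 : v 1 = 0 := (mul_eq_zero.1 (show X 0 * v 1 = 0 by
    linear_combination h0)).resolve_left (X_ne_zero 0)
  have e2 : v 2 = 0 := (mul_eq_zero.1 (show X 0 * v 2 = 0 by
    linear_combination h2)).resolve_left (X_ne_zero 0)
  funext i
  fin_cases i
  exacts [e0, e1, e2]

/-- The entries 3, 6, 7 are those that `M₃` can reduce modulo `X 4`; the other five columns of `M₂`,
in rows 1 to 5, form the monic matrix `X 4 • 1 + M₂Rest`. -/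
theorem M₂_kernel_of_mem_freeOf {v : Fin 8 → S k} (h : (M₂ k).mulVec v = 0)
    (f3 : v 3 ∈ freeOf k 4) (f6 : v 6 ∈ freeOf k 4) (f7 : v 7 ∈ freeOf k 4) : v = 0 := by
  rw [M₂_mulVec] at h
  have h1 : -(X 4 * v 0) + X 2 * v 1 - X 3 * v 2 + X 1 * v 3 + X 0 * v 6 = 0 := congrFun h 1
  have h2 : X 5 * v 0 + X 4 * v 2 + X 2 * v 3 + X 1 * v 4 + X 2 * v 5 + X 0 * v 7 = 0 :=
    congrFun h 2
  have h3 : -(X 4 * v 1) - X 3 * v 3 - X 3 * v 5 - X 1 * v 6 = 0 := congrFun h 3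
  have h4 : X 5 * v 1 - X 3 * v 4 + X 4 * v 5 + X 2 * v 6 - X 1 * v 7 = 0 := congrFun h 4
  have h5 : X 5 * v 3 + X 4 * v 4 + X 2 * v 7 = 0 := congrFun h 5
  have hfree {i : Fin 6} (hi : i ≠ 4) {p : S k} (hp : p ∈ freeOf k 4) : X i * p ∈ freeOf k 4 :=
    mul_mem (X_mem_freeOf hi) hp
  -- The signs and the order 0, 2, 1, 5, 4 put the `X 4` of rows 1 to 5 on the diagonal.
  have hu := monic_kernel (n := 4) (M₂Rest_mem (k := k)) (u := ![-v 0, v 2, -v 1, v 5, v 4]) (by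
    intro i
    fin_cases i
    · convert neg_mem (add_mem (hfree (i := 1) (by decide) f3) (hfree (i := 0) (by decide) f6))
        using 1
      simp [M₂Rest, Fin.sum_univ_succ]
      linear_combination h1
    · convert neg_mem (add_mem (hfree (i := 2) (by decide) f3) (hfree (i := 0) (by decide) f7))
        using 1
      simp [M₂Rest, Fin.sum_univ_succ]
      linear_combination h2
    · convert add_mem (hfree (i := 3) (by decide) f3) (hfree (i := 1) (by decide) f6) using 1
      simp [M₂Rest, Fin.sum_univ_succ]
      linear_combination h3
    · convert sub_mem (hfree (i := 1) (by decide) f7) (hfree (i := 2) (by decide) f6) using 1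
      simp [M₂Rest, Fin.sum_univ_succ]
      linear_combination h4
    · convert neg_mem (add_mem (hfree (i := 5) (by decide) f3) (hfree (i := 2) (by decide) f7))
        using 1
      simp [M₂Rest, Fin.sum_univ_succ]
      linear_combination h5)
  have v0 : v 0 = 0 := neg_eq_zero.1 (congrFun hu 0)
  have v2 : v 2 = 0 := congrFun hu 1
  have v1 : v 1 = 0 := neg_eq_zero.1 (congrFun hu 2)
  have v5 : v 5 = 0 := congrFun hu 3
  have v4 : v 4 = 0 := congrFun hu 4
  rw [v0, v1, v2] at h1
  rw [v0, v2, v4, v5] at h2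
  rw [v1, v5] at h3
  -- `v 3` and `v 6` now satisfy two linear equations with determinant `Δ₂₂`.
  have v3 : v 3 = 0 := (mul_eq_zero.1 (show (X 0 * X 3 - X 1 ^ 2) * v 3 = 0 by
    linear_combination -X 0 * h3 - X 1 * h1)).resolve_left minor_ne_zero
  rw [v3] at h1 h2
  have v6 : v 6 = 0 := (mul_eq_zero.1 (show X 0 * v 6 = 0 by
    linear_combination h1)).resolve_left (X_ne_zero 0)
  have v7 : v 7 = 0 := (mul_eq_zero.1 (show X 0 * v 7 = 0 by
    linear_combination h2)).resolve_left (X_ne_zero 0)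
  funext i
  fin_cases i
  exacts [v0, v1, v2, v3, v4, v5, v6, v7]

theorem M₂_kernel {v : Fin 8 → S k} (h : (M₂ k).mulVec v = 0) :
    ∃ u, (M₃ k).mulVec u = v := by
  -- Rows 3, 6 and minus row 7 of `M₃` form `X 4 • 1 + M₃Rest`; the sign makes the last diagonal
  -- entry `X 4`.
  obtain ⟨u, w, hw, e⟩ := monic_div (M₃Rest_mem (k := k)) ![v 3, v 6, -v 7]
  refine ⟨u, (sub_eq_zero.1 (M₂_kernel_of_mem_freeOf (v := v - (M₃ k).mulVec u) ?_ ?_ ?_ ?_)).symm⟩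
  · rw [Matrix.mulVec_sub, h, Matrix.mulVec_mulVec, M₂_mul_M₃, Matrix.zero_mulVec, sub_zero]
  · convert hw 0 using 1
    have := e 0
    simp [M₃Rest, Fin.sum_univ_succ] at this
    simp [M₃_mulVec, this]
  · convert hw 1 using 1
    have := e 1
    simp [M₃Rest, Fin.sum_univ_succ] at this
    simp [M₃_mulVec, this]
  · convert neg_mem (hw 2) using 1
    have := e 2
    simp [M₃Rest, Fin.sum_univ_succ] at this
    simp [M₃_mulVec]
    linear_combination -this

/-- The relation reads `(X 4 ^ 2 - X 3 * X 5) * v 0 = w₀ + X 4 * w₁` with `w₀`, `w₁` free of `X 4`,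
so `v 0`, `w₀` and `w₁` vanish. The equation `w₁ = 0` is a syzygy of `X 2, X 1, X 0`, hence Koszul;
substituted into `w₀ = 0`, it leaves a syzygy of `Δ₁₁` and `Δ₂₂`. -/
theorem M₁_kernel_of_mem_freeOf {v : Fin 6 → S k} (h : (M₁ k).mulVec v = 0)
    (hv : ∀ i, i ≠ 0 → v i ∈ freeOf k 4) : ∃ z, (M₂ k).mulVec z = v := by
  rw [M₁_mulVec] at h
  have h0 := congrFun h 0
  simp only [Matrix.cons_val_fin_one, Pi.zero_apply] at h0
  have hx {i : Fin 6} (hi : i ≠ 4) : (X i : S k) ∈ freeOf k 4 := X_mem_freeOf hi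
  obtain ⟨v0, e0, e1⟩ := quadratic_kernel (n := 4) (q := X 3 * X 5) (u := v 0)
    (w₀ := X 1 * X 5 * v 1 - X 2 * X 3 * v 2 + (X 0 * X 5 - X 2 ^ 2) * v 3 - X 1 * X 2 * v 4
      + (X 0 * X 3 - X 1 ^ 2) * v 5)
    (w₁ := X 2 * -v 1 + X 1 * v 2 + X 0 * v 4)
    (mul_mem (hx (by decide)) (hx (by decide)))
    (add_mem (sub_mem (add_mem (sub_mem
      (mul_mem (mul_mem (hx (by decide)) (hx (by decide))) (hv 1 (by decide)))
      (mul_mem (mul_mem (hx (by decide)) (hx (by decide))) (hv 2 (by decide))))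
      (mul_mem (sub_mem (mul_mem (hx (by decide)) (hx (by decide))) (pow_mem (hx (by decide)) 2))
        (hv 3 (by decide))))
      (mul_mem (mul_mem (hx (by decide)) (hx (by decide))) (hv 4 (by decide))))
      (mul_mem (sub_mem (mul_mem (hx (by decide)) (hx (by decide))) (pow_mem (hx (by decide)) 2))
        (hv 5 (by decide))))
    (add_mem (add_mem (mul_mem (hx (by decide)) (neg_mem (hv 1 (by decide))))
      (mul_mem (hx (by decide)) (hv 2 (by decide)))) (mul_mem (hx (by decide)) (hv 4 (by decide))))
    (by linear_combination -h0)
  obtain ⟨r, s, t, v1, v2, v4⟩ := koszul_three (by decide) (by decide) (by decide) e1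
  have hx' {i : Fin 6} (hi : i ≠ 2) : (X i : S k) ∈ freeOf k 2 := X_mem_freeOf hi
  obtain ⟨c, v5, v3⟩ := quadratic_syzygy (n := 2) (p := X 0 * X 5) (q := X 0 * X 3 - X 1 ^ 2)
    (v := v 3 - X 3 * r - X 1 * s) (w := v 5 + X 5 * r - X 2 * t)
    (mul_mem (hx' (by decide)) (hx' (by decide)))
    (sub_mem (mul_mem (hx' (by decide)) (hx' (by decide))) (pow_mem (hx' (by decide)) 2))
    minor_ne_zero
    (by
      rw [v2, v4, neg_eq_iff_eq_neg.1 v1] at e0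
      linear_combination -e0)
  -- Columns 3, 6, 7 of `M₂` carry the Koszul coefficients `r, s, t`. Their combination with
  -- coefficients `-X 0, X 1, X 2` is the Koszul relation between `Δ₁₁` and `Δ₂₂`, which absorbs
  -- `c`.
  refine ⟨![0, 0, 0, -r - X 0 * c, 0, 0, -s + X 1 * c, t + X 2 * c], ?_⟩
  rw [M₂_mulVec]
  funext i
  fin_cases i <;> simp
  · exact v0.symm
  · linear_combination v1
  · linear_combination -v2
  · linear_combination -v3
  · linear_combination -v4
  · linear_combination -v5

theorem M₁_kernel {v : Fin 6 → S k} (h : (M₁ k).mulVec v = 0) :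
    ∃ z, (M₂ k).mulVec z = v := by
  obtain ⟨u, w, hw, e⟩ := monic_div (M₂Rest_mem (k := k)) ![v 1, v 2, v 3, v 4, v 5]
  -- Entries 1 to 5 of `M₂ y` are `(X 4 • 1 + M₂Rest) u`; subtracting `M₂ y` leaves the remainder
  -- `w` there.
  let y : Fin 8 → S k := ![-u 0, -u 2, u 1, 0, u 4, u 3, 0, 0]
  obtain ⟨z, hz⟩ := M₁_kernel_of_mem_freeOf (v := v - (M₂ k).mulVec y)
    (by rw [Matrix.mulVec_sub, h, Matrix.mulVec_mulVec, M₁_mul_M₂, Matrix.zero_mulVec, sub_zero])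
    (by
      intro i hi
      obtain ⟨j, rfl⟩ := Fin.exists_succ_eq.2 hi
      convert hw j using 1
      have := e j
      rw [M₂_mulVec]
      fin_cases j <;> simp [M₂Rest, Fin.sum_univ_succ] at this <;> simp [y] <;>
        linear_combination this)
  exact ⟨y + z, by rw [Matrix.mulVec_add, hz, add_sub_cancel]⟩

end Veronese

end VeroneseCurve

namespace VeroneseCurve

/-! ### Lifting through `theta`, and its kernel -/

section LiftThroughTheta

variable {k : Type*} [Field k]

theorem parity_cases {e : Fin 3 →₀ ℕ} (he : Even (e 0 + e 1 + e 2)) :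
    ∃ a b c : ℕ, (e 0 = 2 * a ∧ e 1 = 2 * b ∧ e 2 = 2 * c) ∨
      (e 0 = 2 * a ∧ e 1 = 2 * b + 1 ∧ e 2 = 2 * c + 1) ∨
      (e 0 = 2 * a + 1 ∧ e 1 = 2 * b ∧ e 2 = 2 * c + 1) ∨
      (e 0 = 2 * a + 1 ∧ e 1 = 2 * b + 1 ∧ e 2 = 2 * c) := by
  obtain ⟨s, hs⟩ := he
  refine ⟨e 0 / 2, e 1 / 2, e 2 / 2, ?_⟩
  omega

section Values

variable {e : Fin 3 →₀ ℕ} {a b c : ℕ}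

theorem liftMonomial_even (h : e 0 = 2 * a ∧ e 1 = 2 * b ∧ e 2 = 2 * c) :
    liftMonomial k e = X 0 ^ a * X 3 ^ b * X 5 ^ c := by
  have (n : ℕ) : ¬ Odd (2 * n) := by simp
  simp [liftMonomial, h, this]

theorem liftMonomial_odd_one_two (h : e 0 = 2 * a ∧ e 1 = 2 * b + 1 ∧ e 2 = 2 * c + 1) :
    liftMonomial k e = X 0 ^ a * X 3 ^ b * X 5 ^ c * X 4 := by
  have h1 : (2 * b + 1) / 2 = b := by omega
  have h2 : (2 * c + 1) / 2 = c := by omega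
  simp [liftMonomial, h, h1, h2]

theorem liftMonomial_odd_zero_two (h : e 0 = 2 * a + 1 ∧ e 1 = 2 * b ∧ e 2 = 2 * c + 1) :
    liftMonomial k e = X 0 ^ a * X 3 ^ b * X 5 ^ c * X 2 := by
  have h1 : (2 * a + 1) / 2 = a := by omega
  have h2 : (2 * c + 1) / 2 = c := by omega
  simp [liftMonomial, h, h1, h2]

theorem liftMonomial_odd_zero_one (h : e 0 = 2 * a + 1 ∧ e 1 = 2 * b + 1 ∧ e 2 = 2 * c) :
    liftMonomial k e = X 0 ^ a * X 3 ^ b * X 5 ^ c * X 1 := by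
  have h1 : (2 * a + 1) / 2 = a := by omega
  have h2 : (2 * b + 1) / 2 = b := by omega
  have h3 : ¬ Odd (2 * c) := by simp
  simp [liftMonomial, h, h1, h2, h3]

end Values

theorem monomial_fin_three (e : Fin 3 →₀ ℕ) :
    (monomial e 1 : MvPolynomial (Fin 3) k) = X 0 ^ e 0 * X 1 ^ e 1 * X 2 ^ e 2 := by
  rw [monomial_eq, C_1, one_mul, Finsupp.prod_fintype _ _ fun i => pow_zero _,
    Fin.prod_univ_three]

theorem theta_X (i : Fin 6) :
    theta k (X i) = veroneseVec (fun i => (X i : MvPolynomial (Fin 3) k)) i := by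
  simp [theta]

theorem theta_X_eq : theta k (X 0) = X 0 ^ 2 ∧ theta k (X 1) = X 0 * X 1 ∧
    theta k (X 2) = X 0 * X 2 ∧ theta k (X 3) = X 1 ^ 2 ∧ theta k (X 4) = X 1 * X 2 ∧
    theta k (X 5) = X 2 ^ 2 :=
  ⟨theta_X 0, theta_X 1, theta_X 2, theta_X 3, theta_X 4, theta_X 5⟩

theorem theta_liftMonomial {e : Fin 3 →₀ ℕ} (he : Even (e 0 + e 1 + e 2)) :
    theta k (liftMonomial k e) = monomial e 1 := by
  obtain ⟨t0, t1, t2, t3, t4, t5⟩ := theta_X_eq (k := k)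
  obtain ⟨a, b, c, h | h | h | h⟩ := parity_cases he
  · rw [liftMonomial_even h, monomial_fin_three, h.1, h.2.1, h.2.2]
    simp only [map_mul, map_pow, t0, t3, t5]
    ring
  · rw [liftMonomial_odd_one_two h, monomial_fin_three, h.1, h.2.1, h.2.2]
    simp only [map_mul, map_pow, t0, t3, t5, t4]
    ring
  · rw [liftMonomial_odd_zero_two h, monomial_fin_three, h.1, h.2.1, h.2.2]
    simp only [map_mul, map_pow, t0, t3, t5, t2]
    ring
  · rw [liftMonomial_odd_zero_one h, monomial_fin_three, h.1, h.2.1, h.2.2]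
    simp only [map_mul, map_pow, t0, t3, t5, t1]
    ring

theorem isHomogeneous_liftMonomial {e : Fin 3 →₀ ℕ} {m : ℕ} (he : e 0 + e 1 + e 2 = 2 * m) :
    (liftMonomial k e).IsHomogeneous m := by
  have hp (a b c : ℕ) :
      (X 0 ^ a * X 3 ^ b * X 5 ^ c : S k).IsHomogeneous (a + b + c) :=
    ((isHomogeneous_X_pow 0 a).mul (isHomogeneous_X_pow 3 b)).mul (isHomogeneous_X_pow 5 c)
  obtain ⟨a, b, c, h | h | h | h⟩ := parity_cases (e := e) (he ▸ even_two_mul m)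
  · rw [liftMonomial_even h, show m = a + b + c by omega]
    exact hp a b c
  · rw [liftMonomial_odd_one_two h, show m = a + b + c + 1 by omega]
    exact (hp a b c).mul (isHomogeneous_X k 4)
  · rw [liftMonomial_odd_zero_two h, show m = a + b + c + 1 by omega]
    exact (hp a b c).mul (isHomogeneous_X k 2)
  · rw [liftMonomial_odd_zero_one h, show m = a + b + c + 1 by omega]
    exact (hp a b c).mul (isHomogeneous_X k 1)

theorem sum_of_mem_support {f : MvPolynomial (Fin 3) k} {n : ℕ} (hf : f.IsHomogeneous n)
    {e : Fin 3 →₀ ℕ} (he : e ∈ f.support) : e 0 + e 1 + e 2 = n := by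
  rw [hf.degree_eq_sum_deg_support he, ← Finsupp.degree_apply, Finsupp.degree_eq_sum,
    Fin.sum_univ_three]

theorem isHomogeneous_evenLift {f : MvPolynomial (Fin 3) k} {m : ℕ}
    (hf : f.IsHomogeneous (2 * m)) : (evenLift f).IsHomogeneous m :=
  IsHomogeneous.sum _ _ _ fun _ he =>
    (isHomogeneous_liftMonomial (sum_of_mem_support hf he)).C_mul _

theorem theta_evenLift {f : MvPolynomial (Fin 3) k} {m : ℕ}
    (hf : f.IsHomogeneous (2 * m)) : theta k (evenLift f) = f := by
  conv_rhs => rw [f.as_sum]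
  rw [evenLift, map_sum]
  refine Finset.sum_congr rfl fun e he => ?_
  rw [map_mul, theta_liftMonomial (sum_of_mem_support hf he ▸ even_two_mul m),
    ← algebraMap_eq, AlgHom.commutes, algebraMap_eq, C_mul_monomial, mul_one]

/-- The linear extension of `liftMonomial`. -/
noncomputable def linearLift (k : Type*) [Field k] : MvPolynomial (Fin 3) k →ₗ[k] S k :=
  (basisMonomials (Fin 3) k).constr k (liftMonomial k)

theorem linearLift_monomial (e : Fin 3 →₀ ℕ) (a : k) :
    linearLift k (monomial e a) = C a * liftMonomial k e := by
  have h : (monomial e a : MvPolynomial (Fin 3) k) = a • basisMonomials (Fin 3) k e := by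
    rw [coe_basisMonomials, smul_monomial, smul_eq_mul, mul_one]
  rw [h, map_smul, linearLift, Module.Basis.constr_basis, smul_eq_C_mul]

variable (k) in
/-- The ideal generated by the minors. -/
noncomputable def minorIdeal : Ideal (S k) := Ideal.span (Set.range (minors k))

theorem minors_mem (i : Fin 6) : minors k i ∈ minorIdeal k := Ideal.subset_span ⟨i, rfl⟩

/-- The exponent of `θ(X i)`. -/
noncomputable def thetaExp (i : Fin 6) : Fin 3 →₀ ℕ :=
  Finsupp.equivFunOnFinite.symm
    (![![2, 0, 0], ![1, 1, 0], ![1, 0, 1], ![0, 2, 0], ![0, 1, 1], ![0, 0, 2]] i)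

theorem theta_X_eq_monomial (i : Fin 6) : theta k (X i) = monomial (thetaExp i) 1 := by
  rw [theta_X, monomial_fin_three]
  fin_cases i <;> simp [thetaExp, veroneseVec]

theorem even_thetaExp (i : Fin 6) : Even (thetaExp i 0 + thetaExp i 1 + thetaExp i 2) := by
  fin_cases i <;> simp [thetaExp]

/-- The lifts serve as normal forms modulo the minors. Multiplication by a variable either gives a
normal form at once or needs a single minor to rewrite a product of two variables. -/
theorem liftMonomial_mul_X_sub_mem {e : Fin 3 →₀ ℕ} (he : Even (e 0 + e 1 + e 2)) (i : Fin 6) :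
    liftMonomial k e * X i - liftMonomial k (e + thetaExp i) ∈ minorIdeal k := by
  have m0 : (X 3 * X 5 - X 4 ^ 2 : S k) ∈ minorIdeal k := minors_mem 0
  have m1 : (X 1 * X 5 - X 4 * X 2 : S k) ∈ minorIdeal k := minors_mem 1
  have m2 : (X 1 * X 4 - X 2 * X 3 : S k) ∈ minorIdeal k := minors_mem 2
  have m3 : (X 0 * X 5 - X 2 ^ 2 : S k) ∈ minorIdeal k := minors_mem 3
  have m4 : (X 0 * X 4 - X 2 * X 1 : S k) ∈ minorIdeal k := minors_mem 4
  have m5 : (X 0 * X 3 - X 1 ^ 2 : S k) ∈ minorIdeal k := minors_mem 5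
  have of_eq {p q r : S k} (g : S k) (hr : r ∈ minorIdeal k) (h : p - q = g * r) :
      p - q ∈ minorIdeal k := h ▸ Ideal.mul_mem_left _ g hr
  obtain ⟨a, b, c, h | h | h | h⟩ := parity_cases he
  · rw [liftMonomial_even h]
    obtain ⟨h0, h1, h2⟩ := h
    match i with
    | 0 =>
      rw [liftMonomial_even (a := a + 1) (b := b) (c := c)
        (by simp [thetaExp, h0, h1, h2]; try omega)]
      -- The coefficient `0` marks the cases where both sides are equal; the choice of minor is then
      -- immaterial.
      exact of_eq 0 m0 (by ring)
    | 1 =>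
      rw [liftMonomial_odd_zero_one (a := a) (b := b) (c := c)
        (by simp [thetaExp, h0, h1, h2]; try omega)]
      exact of_eq 0 m0 (by ring)
    | 2 =>
      rw [liftMonomial_odd_zero_two (a := a) (b := b) (c := c)
        (by simp [thetaExp, h0, h1, h2]; try omega)]
      exact of_eq 0 m0 (by ring)
    | 3 =>
      rw [liftMonomial_even (a := a) (b := b + 1) (c := c)
        (by simp [thetaExp, h0, h1, h2]; try omega)]
      exact of_eq 0 m0 (by ring)
    | 4 =>
      rw [liftMonomial_odd_one_two (a := a) (b := b) (c := c)
        (by simp [thetaExp, h0, h1, h2]; try omega)]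
      exact of_eq 0 m0 (by ring)
    | 5 =>
      rw [liftMonomial_even (a := a) (b := b) (c := c + 1)
        (by simp [thetaExp, h0, h1, h2]; try omega)]
      exact of_eq 0 m0 (by ring)
  · rw [liftMonomial_odd_one_two h]
    obtain ⟨h0, h1, h2⟩ := h
    match i with
    | 0 =>
      rw [liftMonomial_odd_one_two (a := a + 1) (b := b) (c := c)
        (by simp [thetaExp, h0, h1, h2]; try omega)]
      exact of_eq 0 m0 (by ring)
    | 1 =>
      rw [liftMonomial_odd_zero_two (a := a) (b := b + 1) (c := c)
        (by simp [thetaExp, h0, h1, h2]; try omega)]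
      exact of_eq (X 0 ^ a * X 3 ^ b * X 5 ^ c) m2 (by ring)
    | 2 =>
      rw [liftMonomial_odd_zero_one (a := a) (b := b) (c := c + 1)
        (by simp [thetaExp, h0, h1, h2]; try omega)]
      exact of_eq (-(X 0 ^ a * X 3 ^ b * X 5 ^ c)) m1 (by ring)
    | 3 =>
      rw [liftMonomial_odd_one_two (a := a) (b := b + 1) (c := c)
        (by simp [thetaExp, h0, h1, h2]; try omega)]
      exact of_eq 0 m0 (by ring)
    | 4 =>
      rw [liftMonomial_even (a := a) (b := b + 1) (c := c + 1)
        (by simp [thetaExp, h0, h1, h2]; try omega)]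
      exact of_eq (-(X 0 ^ a * X 3 ^ b * X 5 ^ c)) m0 (by ring)
    | 5 =>
      rw [liftMonomial_odd_one_two (a := a) (b := b) (c := c + 1)
        (by simp [thetaExp, h0, h1, h2]; try omega)]
      exact of_eq 0 m0 (by ring)
  · rw [liftMonomial_odd_zero_two h]
    obtain ⟨h0, h1, h2⟩ := h
    match i with
    | 0 =>
      rw [liftMonomial_odd_zero_two (a := a + 1) (b := b) (c := c)
        (by simp [thetaExp, h0, h1, h2]; try omega)]
      exact of_eq 0 m0 (by ring)
    | 1 =>
      rw [liftMonomial_odd_one_two (a := a + 1) (b := b) (c := c)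
        (by simp [thetaExp, h0, h1, h2]; try omega)]
      exact of_eq (-(X 0 ^ a * X 3 ^ b * X 5 ^ c)) m4 (by ring)
    | 2 =>
      rw [liftMonomial_even (a := a + 1) (b := b) (c := c + 1)
        (by simp [thetaExp, h0, h1, h2]; try omega)]
      exact of_eq (-(X 0 ^ a * X 3 ^ b * X 5 ^ c)) m3 (by ring)
    | 3 =>
      rw [liftMonomial_odd_zero_two (a := a) (b := b + 1) (c := c)
        (by simp [thetaExp, h0, h1, h2]; try omega)]
      exact of_eq 0 m0 (by ring)
    | 4 =>
      rw [liftMonomial_odd_zero_one (a := a) (b := b) (c := c + 1)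
        (by simp [thetaExp, h0, h1, h2]; try omega)]
      exact of_eq (-(X 0 ^ a * X 3 ^ b * X 5 ^ c)) m1 (by ring)
    | 5 =>
      rw [liftMonomial_odd_zero_two (a := a) (b := b) (c := c + 1)
        (by simp [thetaExp, h0, h1, h2]; try omega)]
      exact of_eq 0 m0 (by ring)
  · rw [liftMonomial_odd_zero_one h]
    obtain ⟨h0, h1, h2⟩ := h
    match i with
    | 0 =>
      rw [liftMonomial_odd_zero_one (a := a + 1) (b := b) (c := c)
        (by simp [thetaExp, h0, h1, h2]; try omega)]
      exact of_eq 0 m0 (by ring)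
    | 1 =>
      rw [liftMonomial_even (a := a + 1) (b := b + 1) (c := c)
        (by simp [thetaExp, h0, h1, h2]; try omega)]
      exact of_eq (-(X 0 ^ a * X 3 ^ b * X 5 ^ c)) m5 (by ring)
    | 2 =>
      rw [liftMonomial_odd_one_two (a := a + 1) (b := b) (c := c)
        (by simp [thetaExp, h0, h1, h2]; try omega)]
      exact of_eq (-(X 0 ^ a * X 3 ^ b * X 5 ^ c)) m4 (by ring)
    | 3 =>
      rw [liftMonomial_odd_zero_one (a := a) (b := b + 1) (c := c)
        (by simp [thetaExp, h0, h1, h2]; try omega)]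
      exact of_eq 0 m0 (by ring)
    | 4 =>
      rw [liftMonomial_odd_zero_two (a := a) (b := b + 1) (c := c)
        (by simp [thetaExp, h0, h1, h2]; try omega)]
      exact of_eq (X 0 ^ a * X 3 ^ b * X 5 ^ c) m2 (by ring)
    | 5 =>
      rw [liftMonomial_odd_zero_one (a := a) (b := b) (c := c + 1)
        (by simp [thetaExp, h0, h1, h2]; try omega)]
      exact of_eq 0 m0 (by ring)

theorem exists_theta_monomial (s : Fin 6 →₀ ℕ) (a : k) : ∃ (e : Fin 3 →₀ ℕ) (b : k),
    Even (e 0 + e 1 + e 2) ∧ theta k (monomial s a) = monomial e b ∧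
      monomial s a - C b * liftMonomial k e ∈ minorIdeal k := by
  refine induction_on_monomial (motive := fun p => ∃ (e : Fin 3 →₀ ℕ) (b : k),
    Even (e 0 + e 1 + e 2) ∧ theta k p = monomial e b ∧
      p - C b * liftMonomial k e ∈ minorIdeal k) ?_ ?_ s a
  · intro a
    refine ⟨0, a, by simp, ?_, ?_⟩
    · rw [← algebraMap_eq, AlgHom.commutes]
      rfl
    · simp [liftMonomial]
  · rintro p i ⟨e, b, he, h, h'⟩
    refine ⟨e + thetaExp i, b, ?_, ?_, ?_⟩
    · obtain ⟨x, hx⟩ := he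
      obtain ⟨y, hy⟩ := even_thetaExp i
      exact ⟨x + y, by simp only [Finsupp.add_apply]; omega⟩
    · rw [map_mul, h, theta_X_eq_monomial, monomial_mul, mul_one]
    · have := add_mem (Ideal.mul_mem_right (X i) _ h')
        (Ideal.mul_mem_left _ (C b) (liftMonomial_mul_X_sub_mem (k := k) he i))
      convert this using 1
      ring

/-- Only monomials of even degree occur in `theta k p`, so the values of `linearLift` in odd degree
play no role. -/
theorem sub_linearLift_theta_mem (p : S k) : p - linearLift k (theta k p) ∈ minorIdeal k := by
  induction p using MvPolynomial.induction_on' with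
  | monomial s a =>
    obtain ⟨e, b, -, h, h'⟩ := exists_theta_monomial s a
    rwa [h, linearLift_monomial]
  | add p q hp hq =>
    rw [map_add, map_add, add_sub_add_comm]
    exact add_mem hp hq

theorem theta_eq_zero_iff {p : S k} : theta k p = 0 ↔ p ∈ minorIdeal k := by
  constructor
  · intro h
    have := sub_linearLift_theta_mem p
    rwa [h, map_zero, sub_zero] at this
  · intro h
    have hle : minorIdeal k ≤ RingHom.ker (theta k) := by
      rw [minorIdeal, Ideal.span_le]
      rintro _ ⟨i, rfl⟩
      obtain ⟨t0, t1, t2, t3, t4, t5⟩ := theta_X_eq (k := k)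
      rw [SetLike.mem_coe, RingHom.mem_ker]
      fin_cases i <;> simp [minors, t0, t1, t2, t3, t4, t5] <;> ring
    exact hle h

end LiftThroughTheta

end VeroneseCurve

namespace VeroneseCurve

/-! ### Homogeneous ideals of the surface and of the curve -/

section Vanishing

variable {k K : Type*} [Field k] [Field K] [Algebra k K]

theorem aeval_smul {n e : ℕ} {G : MvPolynomial (Fin n) k} (hG : G.IsHomogeneous e) (t : K)
    (w : Fin n → K) : aeval (t • w) G = t ^ e * aeval w G := by
  rw [aeval_def, eval₂_eq, aeval_def, eval₂_eq, Finset.mul_sum]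
  refine Finset.sum_congr rfl fun d hd => ?_
  rw [hG.degree_eq_sum_deg_support hd, ← Finset.prod_pow_eq_pow_sum]
  simp only [Pi.smul_apply, smul_eq_mul, mul_pow, Finset.prod_mul_distrib]
  ring

theorem vanishesAt_mk_iff {n e : ℕ} {G : MvPolynomial (Fin n) k} (hG : G.IsHomogeneous e)
    {w : Fin n → K} (hw : w ≠ 0) :
    VanishesAt G (Projectivization.mk K w hw) ↔ aeval w G = 0 := by
  refine ⟨fun h => h w hw rfl, fun h v hv hvw => ?_⟩
  obtain ⟨t, rfl⟩ := (Projectivization.mk_eq_mk_iff' K v w hv hw).1 hvw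
  rw [aeval_smul hG, h, mul_zero]

theorem aeval_theta (a : Fin 3 → K) (G : S k) :
    aeval a (theta k G) = aeval (veroneseVec a) G := by
  have : (aeval a : MvPolynomial (Fin 3) k →ₐ[k] K).comp (theta k) = aeval (veroneseVec a) := by
    ext i
    rw [AlgHom.comp_apply, theta_X, aeval_X]
    fin_cases i <;> simp [veroneseVec]
  exact DFunLike.congr_fun this G

theorem vanishesAt_veronese_iff {e : ℕ} {G : S k} (hG : G.IsHomogeneous e) {a : Fin 3 → K}
    (ha : a ≠ 0) :
    VanishesAt G (veronese K (Projectivization.mk K a ha)) ↔ aeval a (theta k G) = 0 := by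
  rw [aeval_theta]
  exact vanishesAt_mk_iff hG (veroneseVec_ne_zero ha)

/-- The affine Nullstellensatz also asks for vanishing at the origin, which is not a projective
point. Multiplying `g` by `X 0` supplies it, and primality removes the factor. -/
theorem mem_of_vanishing [IsAlgClosed K] {P : Ideal (MvPolynomial (Fin 3) k)} [hP : P.IsPrime]
    (hX : X 0 ∉ P) {g : MvPolynomial (Fin 3) k}
    (h : ∀ a : Fin 3 → K, a ≠ 0 → (∀ p ∈ P, aeval a p = 0) → aeval a g = 0) : g ∈ P := by
  have h1 : X 0 * g ∈ vanishingIdeal k (zeroLocus K P) := by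
    intro a ha
    rw [map_mul, aeval_X]
    by_cases h0 : a = 0
    · rw [h0, Pi.zero_apply, zero_mul]
    · rw [h a h0 ha, mul_zero]
  rw [IsPrime.vanishingIdeal_zeroLocus] at h1
  exact (hP.mem_or_mem h1).resolve_left hX

theorem homogeneousIdeal_veronese [IsAlgClosed K] :
    homogeneousIdeal k (Set.range (veronese K)) = minorIdeal k := by
  apply le_antisymm
  · refine Ideal.span_le.2 ?_
    rintro G ⟨⟨e, hG⟩, h⟩
    refine theta_eq_zero_iff.1 ((Ideal.mem_bot).1 (mem_of_vanishing (K := K) ?_ fun a ha _ => ?_))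
    · rw [Ideal.mem_bot]
      exact X_ne_zero 0
    · exact (vanishesAt_veronese_iff hG ha).1 (h _ ⟨_, rfl⟩)
  · refine Ideal.span_le.2 ?_
    rintro _ ⟨i, rfl⟩
    refine Ideal.subset_span ⟨⟨2, isHomogeneous_minors k i⟩, ?_⟩
    rintro _ ⟨p, rfl⟩
    induction p using Projectivization.ind with
    | h a ha =>
      rw [vanishesAt_veronese_iff (isHomogeneous_minors k i), theta_eq_zero_iff.2 (minors_mem i),
        map_zero]

/-- The component of `h` in degree `b - a` works. If `b < a`, then `g = 0` and the factor is `0`. -/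
theorem exists_homogeneous_factor {σ : Type*} {a b : ℕ} {f g h : MvPolynomial σ k}
    (hf : f.IsHomogeneous a) (hg : g.IsHomogeneous b) (e : g = f * h) :
    ∃ h' : MvPolynomial σ k, h'.IsHomogeneous (b - a) ∧ g = f * h' := by
  let _ := MvPolynomial.gradedAlgebra (σ := σ) (R := k)
  have hg' : (DirectSum.decompose (homogeneousSubmodule σ k) g b : MvPolynomial σ k) = g :=
    DirectSum.decompose_of_mem_same _ hg
  by_cases hab : a ≤ b
  · refine ⟨_, (DirectSum.decompose (homogeneousSubmodule σ k) h (b - a)).2, ?_⟩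
    rw [← DirectSum.coe_decompose_mul_of_left_mem_of_le _ hf hab, ← e, hg']
  · refine ⟨0, isHomogeneous_zero _ _ _, ?_⟩
    rw [mul_zero, ← hg', e, DirectSum.coe_decompose_mul_of_left_mem_of_not_le _ hf hab]

theorem isHomogeneous_theta {e : ℕ} {G : S k} (hG : G.IsHomogeneous e) :
    (theta k G).IsHomogeneous (2 * e) := by
  refine hG.aeval _ fun i => ?_
  rw [← theta_X, theta_X_eq_monomial]
  apply isHomogeneous_monomial
  rw [Finsupp.degree_eq_sum, Fin.sum_univ_three]
  fin_cases i <;> simp [thetaExp]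

variable {m : ℕ} {f : MvPolynomial (Fin 3) k} {F : S k}

/-- A nonzero multiple of `f` has degree at least `2 * m ≥ 2`. -/
theorem X_zero_notMem_span (hm : 1 ≤ m) (hf : f.IsHomogeneous (2 * m)) (hf0 : f ≠ 0) :
    X 0 ∉ Ideal.span {f} := by
  rw [Ideal.mem_span_singleton]
  rintro ⟨g, hg⟩
  have hg0 : g ≠ 0 := by
    rintro rfl
    exact X_ne_zero (R := k) (0 : Fin 3) (by rw [hg, mul_zero])
  have := congrArg totalDegree hg
  rw [totalDegree_X, totalDegree_mul_of_isDomain hf0 hg0, hf.totalDegree hf0] at this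
  omega

theorem homogeneousIdeal_curve [IsAlgClosed K] (hm : 1 ≤ m) (hf : f.IsHomogeneous (2 * m))
    (hirr : Irreducible f) (hF : F.IsHomogeneous m) (hFf : theta k F = f) :
    homogeneousIdeal k (veronese K '' zeroSet K f) =
      Ideal.span (Set.range (minors k) ∪ {F}) := by
  apply le_antisymm
  · refine Ideal.span_le.2 ?_
    rintro G ⟨⟨e, hG⟩, h⟩
    have : (Ideal.span {f}).IsPrime := (Ideal.span_singleton_prime hirr.ne_zero).2 hirr.prime
    have hmem : theta k G ∈ Ideal.span {f} := by
      refine mem_of_vanishing (K := K) (X_zero_notMem_span hm hf hirr.ne_zero) fun a ha hP => ?_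
      refine (vanishesAt_veronese_iff hG ha).1 (h _ ⟨_, ?_, rfl⟩)
      exact (vanishesAt_mk_iff hf ha).2 (hP f (Ideal.mem_span_singleton_self f))
    obtain ⟨h₀, hh₀⟩ := Ideal.mem_span_singleton.1 hmem
    obtain ⟨h₁, hh₁, e₁⟩ := exists_homogeneous_factor hf (isHomogeneous_theta hG) hh₀
    -- The cofactor has even degree, so `evenLift` lifts it to a form of `S`.
    rw [← Nat.mul_sub] at hh₁
    have hker : G - evenLift h₁ * F ∈ minorIdeal k := by
      rw [← theta_eq_zero_iff, map_sub, map_mul, theta_evenLift hh₁, hFf, e₁]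
      ring
    rw [SetLike.mem_coe, ← sub_add_cancel G (evenLift h₁ * F)]
    exact add_mem (Ideal.span_mono Set.subset_union_left hker)
      (Ideal.mul_mem_left _ _ (Ideal.subset_span (Or.inr rfl)))
  · refine Ideal.span_le.2 ?_
    rintro _ (⟨i, rfl⟩ | rfl)
    · refine Ideal.subset_span ⟨⟨2, isHomogeneous_minors k i⟩, ?_⟩
      rintro _ ⟨p, -, rfl⟩
      induction p using Projectivization.ind with
      | h a ha =>
        rw [vanishesAt_veronese_iff (isHomogeneous_minors k i),
          theta_eq_zero_iff.2 (minors_mem i), map_zero]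
    · refine Ideal.subset_span ⟨⟨m, hF⟩, ?_⟩
      rintro _ ⟨p, hp, rfl⟩
      induction p using Projectivization.ind with
      | h a ha =>
        rw [vanishesAt_veronese_iff hF, hFf]
        exact (vanishesAt_mk_iff hf ha).1 hp

end Vanishing

end VeroneseCurve

namespace VeroneseCurve

/-! ### The minimal free resolutions -/

section Exactness

variable {k : Type*} [Field k]

theorem constantCoeff_of_isHomogeneous {n e : ℕ} {p : MvPolynomial (Fin n) k}
    (hp : p.IsHomogeneous e) (he : e ≠ 0) : constantCoeff p = 0 := by
  rw [constantCoeff_eq]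
  exact hp.coeff_eq_zero (by simpa using he.symm)

theorem const_apply_zero (v : Fin 1 → S k) : (fun _ => v 0) = v := by
  funext i
  rw [Subsingleton.elim i 0]

theorem constantCoeff_smul_one {ι : Type} [DecidableEq ι] {F : S k} (hF : constantCoeff F = 0)
    (i j : ι) : constantCoeff ((F • (1 : Matrix ι ι (S k))) i j) = 0 := by
  rw [Matrix.smul_apply, smul_eq_mul, map_mul, hF, zero_mul]

theorem mem_minorIdeal_iff {p : S k} :
    p ∈ minorIdeal k ↔ ∃ v, (M₁ k).mulVec v = fun _ => p := by
  rw [minorIdeal, Ideal.mem_span_range_iff_exists_fun]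
  refine exists_congr fun v => ?_
  have : (M₁ k).mulVec v = fun _ => ∑ i, v i * minors k i := by
    funext i
    fin_cases i
    exact Fintype.sum_congr _ _ fun j => mul_comm (minors k j) (v j)
  rw [this]
  exact ⟨fun h => by rw [h], fun h => congrFun h 0⟩

/-- The kernel of `theta` is prime, its target being a domain. -/
theorem mul_mem_minorIdeal {F g : S k} (hF : theta k F ≠ 0) (h : F * g ∈ minorIdeal k) :
    g ∈ minorIdeal k := by
  rw [← theta_eq_zero_iff, map_mul] at h
  exact theta_eq_zero_iff.1 ((mul_eq_zero.1 h).resolve_left hF)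

theorem exact_mulVecLin {l m n : Type} [Fintype l] [Fintype m] [Fintype n]
    {A : Matrix l m (S k)} {B : Matrix m n (S k)} (hAB : A * B = 0)
    (h : ∀ v, A.mulVec v = 0 → ∃ u, B.mulVec u = v) :
    Function.Exact B.mulVecLin A.mulVecLin := by
  intro v
  refine ⟨fun hv => h v hv, ?_⟩
  rintro ⟨u, rfl⟩
  rw [Matrix.mulVecLin_apply, Matrix.mulVecLin_apply, Matrix.mulVec_mulVec, hAB,
    Matrix.zero_mulVec]

theorem augmentation_eq_zero_iff {I : Ideal (S k)} {v : Fin 1 → S k} :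
    augmentation I v = 0 ↔ v 0 ∈ I :=
  Submodule.Quotient.mk_eq_zero I

theorem augmentation_surjective (I : Ideal (S k)) : Function.Surjective (augmentation I) := by
  intro q
  obtain ⟨p, rfl⟩ := Submodule.Quotient.mk_surjective I q
  exact ⟨fun _ => p, rfl⟩

theorem veronese_resolution : IsMinimalFreeResolution (veroneseComplex k)
    (augmentation (minorIdeal k)) where
  surjective := augmentation_surjective _
  exact_zero := by
    intro (v : Fin 1 → S k)
    refine augmentation_eq_zero_iff.trans (mem_minorIdeal_iff.trans (exists_congr fun u => ?_))
    rw [const_apply_zero]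
    rfl
  exact_succ i := match i with
    | 0 => exact_mulVecLin (M₁_mul_M₂ k) fun _ => M₁_kernel
    | 1 => exact_mulVecLin (M₂_mul_M₃ k) fun _ => M₂_kernel
    | 2 => exact_mulVecLin ((veroneseComplex k).d_comp_d 2) fun v hv =>
      ⟨0, (Matrix.mulVec_zero _).trans (M₃_kernel hv).symm⟩
    | i + 3 => exact_mulVecLin ((veroneseComplex k).d_comp_d (i + 3)) fun _ _ =>
      ⟨0, funext fun x => Empty.elim x⟩
  minimal i a b := match i, a, b with
    | 0, a, b => constantCoeff_of_isHomogeneous (isHomogeneous_M₁ k a b) two_ne_zero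
    | 1, a, b => constantCoeff_of_isHomogeneous (isHomogeneous_M₂ k a b) one_ne_zero
    | 2, a, b => constantCoeff_of_isHomogeneous (isHomogeneous_M₃ k a b) one_ne_zero
    | _ + 3, _, b => Empty.elim b

variable {F : S k}

theorem sum_elim_eta {α β γ : Type*} (v : α ⊕ β → γ) :
    Sum.elim (fun a => v (Sum.inl a)) (fun b => v (Sum.inr b)) = v :=
  Sum.elim_comp_inl_inr v

/-- This is the only place where `F` must be a nonzerodivisor modulo the minors: `M₁ u + F g = 0`
puts `F g`, hence `g`, in the ideal of the minors. Writing `g = M₁ w` makes `u + F w` a cycle of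
`V`. The later kernels need only the exactness of `V`. -/
theorem M₁'_kernel (hF : theta k F ≠ 0) {v : Fin 6 ⊕ Fin 1 → S k}
    (h : (M₁' F).mulVec v = 0) : ∃ u, (M₂' F).mulVec u = v := by
  obtain ⟨u, g, rfl⟩ : ∃ u g, v = Sum.elim u g := ⟨_, _, (sum_elim_eta v).symm⟩
  rw [M₁', Matrix.fromCols_mulVec_sumElim, Matrix.smul_mulVec, Matrix.one_mulVec] at h
  obtain ⟨w, hw⟩ := mem_minorIdeal_iff.1 (mul_mem_minorIdeal (g := g 0) hF
    (mem_minorIdeal_iff.2 ⟨-u, by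
      rw [Matrix.mulVec_neg, eq_neg_of_add_eq_zero_left h, neg_neg, ← const_apply_zero (F • g)]
      rfl⟩))
  rw [const_apply_zero] at hw
  obtain ⟨z, hz⟩ := M₁_kernel (v := u + F • w) (by
    rw [Matrix.mulVec_add, Matrix.mulVec_smul, hw, h])
  refine ⟨Sum.elim z w, ?_⟩
  rw [M₂', Matrix.fromBlocks_mulVec, Sum.elim_comp_inl, Sum.elim_comp_inr, hz,
    Matrix.smul_mulVec, Matrix.one_mulVec, Matrix.zero_mulVec, zero_add, hw, neg_smul,
    add_neg_cancel_right]

theorem M₂'_kernel {v : Fin 8 ⊕ Fin 6 → S k}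
    (h : (M₂' F).mulVec v = 0) : ∃ u, (M₃' F).mulVec u = v := by
  obtain ⟨u, w, rfl⟩ : ∃ u w, v = Sum.elim u w := ⟨_, _, (sum_elim_eta v).symm⟩
  rw [M₂', Matrix.fromBlocks_mulVec, Sum.elim_comp_inl, Sum.elim_comp_inr,
    Matrix.smul_mulVec, Matrix.one_mulVec, Matrix.zero_mulVec, zero_add, neg_smul] at h
  obtain ⟨z, rfl⟩ := M₁_kernel (v := w) (funext fun i => congrFun h (Sum.inr i))
  have h1 : (M₂ k).mulVec u + -(F • (M₂ k).mulVec z) = 0 :=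
    funext fun i => congrFun h (Sum.inl i)
  obtain ⟨y, hy⟩ := M₂_kernel (v := u - F • z) (by
    rw [Matrix.mulVec_sub, Matrix.mulVec_smul, sub_eq_add_neg, h1])
  refine ⟨Sum.elim y z, ?_⟩
  rw [M₃', Matrix.fromBlocks_mulVec, Sum.elim_comp_inl, Sum.elim_comp_inr, hy,
    Matrix.smul_mulVec, Matrix.one_mulVec, Matrix.zero_mulVec, zero_add, sub_add_cancel]

theorem M₃'_kernel {v : Fin 3 ⊕ Fin 8 → S k}
    (h : (M₃' F).mulVec v = 0) : ∃ u, (M₄' F).mulVec u = v := by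
  obtain ⟨y, z, rfl⟩ : ∃ y z, v = Sum.elim y z := ⟨_, _, (sum_elim_eta v).symm⟩
  rw [M₃', Matrix.fromBlocks_mulVec, Sum.elim_comp_inl, Sum.elim_comp_inr,
    Matrix.smul_mulVec, Matrix.one_mulVec, Matrix.zero_mulVec, zero_add] at h
  obtain ⟨s, rfl⟩ := M₂_kernel (v := z) (funext fun i => congrFun h (Sum.inr i))
  have h1 : (M₃ k).mulVec y + F • (M₃ k).mulVec s = 0 :=
    funext fun i => congrFun h (Sum.inl i)
  have h2 := M₃_kernel (v := y + F • s) (by rw [Matrix.mulVec_add, Matrix.mulVec_smul, h1])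
  refine ⟨s, ?_⟩
  rw [M₄', Matrix.fromRows_mulVec, Matrix.smul_mulVec, Matrix.one_mulVec, neg_smul,
    eq_neg_of_add_eq_zero_left h2]

theorem M₄'_kernel {v : Fin 3 → S k} (h : (M₄' F).mulVec v = 0) : v = 0 := by
  rw [M₄', Matrix.fromRows_mulVec] at h
  exact M₃_kernel (funext fun i => congrFun h (Sum.inr i))

theorem mem_span_minors_union_iff {p : S k} :
    p ∈ Ideal.span (Set.range (minors k) ∪ {F}) ↔ ∃ v, (M₁' F).mulVec v = fun _ => p := by
  have key (u : Fin 6 → S k) (g : S k) :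
      (M₁' F).mulVec (Sum.elim u fun _ => g) = (M₁ k).mulVec u + fun _ => F * g := by
    rw [M₁', Matrix.fromCols_mulVec_sumElim, Matrix.smul_mulVec, Matrix.one_mulVec]
    rfl
  rw [Ideal.span_union, Submodule.mem_sup]
  constructor
  · rintro ⟨y, hy, z, hz, rfl⟩
    obtain ⟨u, hu⟩ := mem_minorIdeal_iff.1 hy
    obtain ⟨g, rfl⟩ := Ideal.mem_span_singleton.1 hz
    exact ⟨Sum.elim u fun _ => g, by rw [key, hu]; rfl⟩
  · rintro ⟨v, hv⟩
    obtain ⟨u, g, rfl⟩ : ∃ u g, v = Sum.elim u g := ⟨_, _, (sum_elim_eta v).symm⟩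
    rw [← const_apply_zero g, key] at hv
    refine ⟨(M₁ k).mulVec u 0, mem_minorIdeal_iff.2 ⟨u, ?_⟩, F * g 0,
      Ideal.mem_span_singleton.2 ⟨_, rfl⟩, congrFun hv 0⟩
    exact (const_apply_zero _).symm

theorem curve_resolution {m : ℕ} (hm : 1 ≤ m) (hF : F.IsHomogeneous m) (hF0 : theta k F ≠ 0) :
    IsMinimalFreeResolution (curveComplex F hF)
      (augmentation (Ideal.span (Set.range (minors k) ∪ {F}))) where
  surjective := augmentation_surjective _
  exact_zero := by
    intro (v : Fin 1 → S k)
    refine augmentation_eq_zero_iff.trans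
      (mem_span_minors_union_iff.trans (exists_congr fun u => ?_))
    rw [const_apply_zero]
    rfl
  exact_succ i := match i with
    | 0 => exact_mulVecLin (M₁'_mul_M₂' F) fun _ => M₁'_kernel hF0
    | 1 => exact_mulVecLin (M₂'_mul_M₃' F) fun _ => M₂'_kernel
    | 2 => exact_mulVecLin (M₃'_mul_M₄' F) fun _ => M₃'_kernel
    | 3 => exact_mulVecLin ((curveComplex F hF).d_comp_d 3) fun v hv =>
      ⟨0, (Matrix.mulVec_zero _).trans (M₄'_kernel hv).symm⟩
    | i + 4 => exact_mulVecLin ((curveComplex F hF).d_comp_d (i + 4)) fun _ _ =>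
      ⟨0, funext fun x => Empty.elim x⟩
  minimal i a b := by
    -- Minimality rests on `m ≥ 1`: the entries `± F` have no constant term.
    have h0 : constantCoeff F = 0 := constantCoeff_of_isHomogeneous hF (by omega)
    have h0' : constantCoeff (-F) = 0 := by rw [map_neg, h0, neg_zero]
    have h1 (i j) : constantCoeff (M₁ k i j) = 0 :=
      constantCoeff_of_isHomogeneous (isHomogeneous_M₁ k i j) two_ne_zero
    have h2 (i j) : constantCoeff (M₂ k i j) = 0 :=
      constantCoeff_of_isHomogeneous (isHomogeneous_M₂ k i j) one_ne_zero
    have h3 (i j) : constantCoeff (M₃ k i j) = 0 :=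
      constantCoeff_of_isHomogeneous (isHomogeneous_M₃ k i j) one_ne_zero
    match i, a, b with
    | 0, a, Sum.inl b => exact h1 a b
    | 0, a, Sum.inr b => exact constantCoeff_smul_one (ι := Fin 1) h0 a b
    | 1, Sum.inl a, Sum.inl b => exact h2 a b
    | 1, Sum.inl a, Sum.inr b => exact constantCoeff_smul_one (ι := Fin 6) h0' a b
    | 1, Sum.inr _, Sum.inl _ => exact map_zero _
    | 1, Sum.inr a, Sum.inr b => exact h1 a b
    | 2, Sum.inl a, Sum.inl b => exact h3 a b
    | 2, Sum.inl a, Sum.inr b => exact constantCoeff_smul_one (ι := Fin 8) h0 a b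
    | 2, Sum.inr _, Sum.inl _ => exact map_zero _
    | 2, Sum.inr a, Sum.inr b => exact h2 a b
    | 3, Sum.inl a, b => exact constantCoeff_smul_one (ι := Fin 3) h0' a b
    | 3, Sum.inr a, b => exact h3 a b
    | _ + 4, _, b => exact Empty.elim b

end Exactness

end VeroneseCurve

namespace VeroneseCurve

/-! ### Comparison with the mapping cone -/

section Cone

variable {k : Type*} [Field k]

theorem isForm_one {ι : Type} [DecidableEq ι] {s t : ι → ℕ} (h : ∀ i, s i = t i) (i j : ι) :
    IsForm (s i) (t j) ((1 : Matrix ι ι (S k)) i j) := by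
  by_cases hij : i = j
  · subst hij
    exact Or.inr ⟨0, h i, by rw [Matrix.one_apply_eq]; exact isHomogeneous_one _ _⟩
  · exact Or.inl (Matrix.one_apply_ne hij)

theorem IsForm.neg {a b : ℕ} {p : S k} (h : IsForm a b p) : IsForm a b (-p) := by
  rcases h with rfl | ⟨e, he, h⟩
  · exact Or.inl neg_zero
  · exact Or.inr ⟨e, he, h.neg⟩

theorem fromBlocks_one_neg_one_mul_self {m n : Type} [Fintype m] [Fintype n] [DecidableEq m]
    [DecidableEq n] : (Matrix.fromBlocks 1 0 0 (-1) : Matrix (m ⊕ n) (m ⊕ n) (S k)) *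
      (Matrix.fromBlocks 1 0 0 (-1) : Matrix (m ⊕ n) (m ⊕ n) (S k)) = 1 := by
  rw [Matrix.fromBlocks_multiply, ← Matrix.fromBlocks_one]
  simp

theorem fromCols_mul_fromRows_empty {n : Type} [Fintype n] [DecidableEq n] :
    (Matrix.fromCols 0 (-1) : Matrix n (Empty ⊕ n) (S k)) *
      (Matrix.fromRows 0 (-1) : Matrix (Empty ⊕ n) n (S k)) = 1 := by
  rw [Matrix.fromCols_mul_fromRows]
  simp

theorem fromRows_mul_fromCols_empty {n : Type} [Fintype n] [DecidableEq n] :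
    (Matrix.fromRows 0 (-1) : Matrix (Empty ⊕ n) n (S k)) *
      (Matrix.fromCols 0 (-1) : Matrix n (Empty ⊕ n) (S k)) = 1 := by
  rw [Matrix.fromRows_mul_fromCols, ← Matrix.fromBlocks_one]
  congr 1
  · ext1 i
    exact Empty.elim i
  · simp
  · simp
  · simp

/-- The matrices of the isomorphism from the complex of the curve to the mapping cone. -/
noncomputable def curveToCone (k : Type*) [Field k] (m : ℕ) : ∀ i,
    Matrix (coneIdx ((veroneseComplex k).twist m) (veroneseComplex k) i) (curveIdx i) (S k)
  | 0 => (1 : Matrix (Fin 1) (Fin 1) (S k))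
  | 1 => (1 : Matrix (Fin 6 ⊕ Fin 1) (Fin 6 ⊕ Fin 1) (S k))
  -- The summand `V_i(-m)` sits in degree `i + 1` and receives the sign `(-1) ^ i`, which absorbs
  -- the minus sign in the cone differential; degrees 2 and 4 are thus the ones that change.
  | 2 => (Matrix.fromBlocks 1 0 0 (-1) : Matrix (Fin 8 ⊕ Fin 6) (Fin 8 ⊕ Fin 6) (S k))
  | 3 => (1 : Matrix (Fin 3 ⊕ Fin 8) (Fin 3 ⊕ Fin 8) (S k))
  -- The cone keeps the zero summand `V₄`, indexed by `Empty`.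
  | 4 => (Matrix.fromRows 0 (-1) : Matrix (Empty ⊕ Fin 3) (Fin 3) (S k))
  | _ + 5 => 0

/-- The matrices of the isomorphism from the mapping cone to the complex of the curve. -/
noncomputable def coneToCurve (k : Type*) [Field k] (m : ℕ) : ∀ i,
    Matrix (curveIdx i) (coneIdx ((veroneseComplex k).twist m) (veroneseComplex k) i) (S k)
  | 0 => (1 : Matrix (Fin 1) (Fin 1) (S k))
  | 1 => (1 : Matrix (Fin 6 ⊕ Fin 1) (Fin 6 ⊕ Fin 1) (S k))
  | 2 => (Matrix.fromBlocks 1 0 0 (-1) : Matrix (Fin 8 ⊕ Fin 6) (Fin 8 ⊕ Fin 6) (S k))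
  | 3 => (1 : Matrix (Fin 3 ⊕ Fin 8) (Fin 3 ⊕ Fin 8) (S k))
  | 4 => (Matrix.fromCols 0 (-1) : Matrix (Fin 3) (Empty ⊕ Fin 3) (S k))
  | _ + 5 => 0

variable {m : ℕ} {F : S k} (hF : F.IsHomogeneous m)

/-- The morphism from the complex of the curve to the mapping cone. -/
noncomputable def curveToConeHom :
    GradedHom (curveComplex F hF) (mappingCone (mulHom (veroneseComplex k) F hF)) where
  f := curveToCone k m
  f_form i b a := match i, b, a with
    | 0, b, a => isForm_one (ι := Fin 1) (fun _ => rfl) b a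
    | 1, b, a => isForm_one (ι := Fin 6 ⊕ Fin 1) (s := Sum.elim (fun _ => 2) fun _ => 0 + m)
      (t := curveTw m 1) (by rintro (i | i) <;> simp [curveTw]) b a
    | 2, Sum.inl b, Sum.inl a => isForm_one (ι := Fin 8) (s := fun _ => 3) (fun _ => rfl) b a
    | 2, Sum.inl _, Sum.inr _ => Or.inl rfl
    | 2, Sum.inr _, Sum.inl _ => Or.inl rfl
    | 2, Sum.inr b, Sum.inr a => IsForm.neg (isForm_one (ι := Fin 6) (s := fun _ => 2 + m)
      (t := fun _ => m + 2) (fun _ => Nat.add_comm _ _) b a)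
    | 3, b, a => isForm_one (ι := Fin 3 ⊕ Fin 8) (s := Sum.elim (fun _ => 4) fun _ => 3 + m)
      (t := curveTw m 3) (by rintro (i | i) <;> simp [curveTw, Nat.add_comm]) b a
    | 4, Sum.inl b, _ => Empty.elim b
    | 4, Sum.inr b, a => IsForm.neg (isForm_one (ι := Fin 3) (s := fun _ => 4 + m)
      (t := fun _ => m + 4) (fun _ => Nat.add_comm _ _) b a)
    | _ + 5, _, a => Empty.elim a
  comm i := match i with
    | 0 => by
      change Matrix.fromCols (M₁ k) (F • (1 : Matrix (Fin 1) (Fin 1) (S k))) *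
        (1 : Matrix (Fin 6 ⊕ Fin 1) (Fin 6 ⊕ Fin 1) (S k)) =
        (1 : Matrix (Fin 1) (Fin 1) (S k)) * M₁' F
      rw [Matrix.mul_one, Matrix.one_mul, M₁']
    | 1 => by
      change Matrix.fromBlocks (M₂ k) (F • (1 : Matrix (Fin 6) (Fin 6) (S k))) 0 (-M₁ k) *
        (Matrix.fromBlocks 1 0 0 (-1) : Matrix (Fin 8 ⊕ Fin 6) (Fin 8 ⊕ Fin 6) (S k)) =
        (1 : Matrix (Fin 6 ⊕ Fin 1) (Fin 6 ⊕ Fin 1) (S k)) * M₂' F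
      rw [Matrix.one_mul, M₂', Matrix.fromBlocks_multiply]
      simp
    | 2 => by
      change Matrix.fromBlocks (M₃ k) (F • (1 : Matrix (Fin 8) (Fin 8) (S k))) 0 (-M₂ k) *
        (1 : Matrix (Fin 3 ⊕ Fin 8) (Fin 3 ⊕ Fin 8) (S k)) =
        (Matrix.fromBlocks 1 0 0 (-1) : Matrix (Fin 8 ⊕ Fin 6) (Fin 8 ⊕ Fin 6) (S k)) * M₃' F
      rw [Matrix.mul_one, M₃', Matrix.fromBlocks_multiply]
      simp
    | 3 => by
      change Matrix.fromBlocks (0 : Matrix (Fin 3) Empty (S k))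
        (F • (1 : Matrix (Fin 3) (Fin 3) (S k))) 0 (-M₃ k) *
        (Matrix.fromRows 0 (-1) : Matrix (Empty ⊕ Fin 3) (Fin 3) (S k)) =
        (1 : Matrix (Fin 3 ⊕ Fin 8) (Fin 3 ⊕ Fin 8) (S k)) * M₄' F
      rw [Matrix.one_mul, M₄', Matrix.fromBlocks_mul_fromRows]
      simp
    | _ + 4 => by
      ext1 _ a
      exact Empty.elim a

/-- The morphism from the mapping cone to the complex of the curve. -/
noncomputable def coneToCurveHom :
    GradedHom (mappingCone (mulHom (veroneseComplex k) F hF)) (curveComplex F hF) where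
  f := coneToCurve k m
  f_form i b a := match i, b, a with
    | 0, b, a => isForm_one (ι := Fin 1) (fun _ => rfl) b a
    | 1, b, a => isForm_one (ι := Fin 6 ⊕ Fin 1) (s := curveTw m 1)
      (t := Sum.elim (fun _ => 2) fun _ => 0 + m) (by rintro (i | i) <;> simp [curveTw]) b a
    | 2, Sum.inl b, Sum.inl a => isForm_one (ι := Fin 8) (s := fun _ => 3) (fun _ => rfl) b a
    | 2, Sum.inl _, Sum.inr _ => Or.inl rfl
    | 2, Sum.inr _, Sum.inl _ => Or.inl rfl
    | 2, Sum.inr b, Sum.inr a => IsForm.neg (isForm_one (ι := Fin 6) (s := fun _ => m + 2)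
      (t := fun _ => 2 + m) (fun _ => Nat.add_comm _ _) b a)
    | 3, b, a => isForm_one (ι := Fin 3 ⊕ Fin 8) (s := curveTw m 3)
      (t := Sum.elim (fun _ => 4) fun _ => 3 + m)
      (by rintro (i | i) <;> simp [curveTw, Nat.add_comm]) b a
    | 4, _, Sum.inl a => Empty.elim a
    | 4, b, Sum.inr a => IsForm.neg (isForm_one (ι := Fin 3) (s := fun _ => m + 4)
      (t := fun _ => 4 + m) (fun _ => Nat.add_comm _ _) b a)
    | _ + 5, b, _ => Empty.elim b
  comm i := match i with
    | 0 => by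
      change M₁' F * (1 : Matrix (Fin 6 ⊕ Fin 1) (Fin 6 ⊕ Fin 1) (S k)) =
        (1 : Matrix (Fin 1) (Fin 1) (S k)) *
          Matrix.fromCols (M₁ k) (F • (1 : Matrix (Fin 1) (Fin 1) (S k)))
      rw [Matrix.mul_one, Matrix.one_mul, M₁']
    | 1 => by
      change M₂' F *
        (Matrix.fromBlocks 1 0 0 (-1) : Matrix (Fin 8 ⊕ Fin 6) (Fin 8 ⊕ Fin 6) (S k)) =
        (1 : Matrix (Fin 6 ⊕ Fin 1) (Fin 6 ⊕ Fin 1) (S k)) *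
          Matrix.fromBlocks (M₂ k) (F • (1 : Matrix (Fin 6) (Fin 6) (S k))) 0 (-M₁ k)
      rw [Matrix.one_mul, M₂', Matrix.fromBlocks_multiply]
      simp
    | 2 => by
      change M₃' F * (1 : Matrix (Fin 3 ⊕ Fin 8) (Fin 3 ⊕ Fin 8) (S k)) =
        (Matrix.fromBlocks 1 0 0 (-1) : Matrix (Fin 8 ⊕ Fin 6) (Fin 8 ⊕ Fin 6) (S k)) *
          Matrix.fromBlocks (M₃ k) (F • (1 : Matrix (Fin 8) (Fin 8) (S k))) 0 (-M₂ k)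
      rw [Matrix.mul_one, M₃', Matrix.fromBlocks_multiply]
      simp
    | 3 => by
      change M₄' F * (Matrix.fromCols 0 (-1) : Matrix (Fin 3) (Empty ⊕ Fin 3) (S k)) =
        (1 : Matrix (Fin 3 ⊕ Fin 8) (Fin 3 ⊕ Fin 8) (S k)) *
          Matrix.fromBlocks (0 : Matrix (Fin 3) Empty (S k))
            (F • (1 : Matrix (Fin 3) (Fin 3) (S k))) 0 (-M₃ k)
      rw [Matrix.one_mul, M₄', Matrix.fromRows_mul_fromCols]
      simp
    | _ + 4 => by
      ext1 _ a
      rcases a with a | a <;> exact Empty.elim a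

/-- The complex of the curve is isomorphic to the mapping cone of multiplication by `F`. -/
noncomputable def curveIsoCone :
    GradedIso (curveComplex F hF) (mappingCone (mulHom (veroneseComplex k) F hF)) where
  hom := curveToConeHom hF
  inv := coneToCurveHom hF
  inv_mul_hom i := match i with
    | 0 => Matrix.mul_one (1 : Matrix (Fin 1) (Fin 1) (S k))
    | 1 => Matrix.mul_one (1 : Matrix (Fin 6 ⊕ Fin 1) (Fin 6 ⊕ Fin 1) (S k))
    | 2 => fromBlocks_one_neg_one_mul_self
    | 3 => Matrix.mul_one (1 : Matrix (Fin 3 ⊕ Fin 8) (Fin 3 ⊕ Fin 8) (S k))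
    | 4 => fromCols_mul_fromRows_empty
    | _ + 5 => by
      ext1 a
      exact Empty.elim a
  hom_mul_inv i := match i with
    | 0 => Matrix.mul_one (1 : Matrix (Fin 1) (Fin 1) (S k))
    | 1 => Matrix.mul_one (1 : Matrix (Fin 6 ⊕ Fin 1) (Fin 6 ⊕ Fin 1) (S k))
    | 2 => fromBlocks_one_neg_one_mul_self
    | 3 => Matrix.mul_one (1 : Matrix (Fin 3 ⊕ Fin 8) (Fin 3 ⊕ Fin 8) (S k))
    | 4 => fromRows_mul_fromCols_empty
    | _ + 5 => by
      ext1 a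
      rcases a with a | a <;> exact Empty.elim a

end Cone

end VeroneseCurve

open VeroneseCurve in
theorem theorem4 {k K : Type*} [Field k] [Field K] [Algebra k K] [IsAlgClosed K]
    (m : ℕ) (hm : 1 ≤ m) (f : MvPolynomial (Fin 3) k)
    (hf : f.IsHomogeneous (2 * m)) (hirr : Irreducible f) :
    (evenLift f).IsHomogeneous m ∧ theta k (evenLift f) = f ∧
    IsMinimalFreeResolution (veroneseComplex k)
      (augmentation (homogeneousIdeal k (Set.range (veronese K)))) ∧
    ∀ (F : S k) (hF : F.IsHomogeneous m), theta k F = f →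
      homogeneousIdeal k (veronese K '' zeroSet K f) =
        Ideal.span (Set.range (minors k) ∪ {F}) ∧
      IsMinimalFreeResolution (curveComplex F hF)
        (augmentation (homogeneousIdeal k (veronese K '' zeroSet K f))) ∧
      Nonempty (GradedIso (curveComplex F hF)
        (mappingCone (mulHom (veroneseComplex k) F hF))) := by
  refine ⟨isHomogeneous_evenLift hf, theta_evenLift hf, ?_, fun F hF hFf => ?_⟩
  · rw [homogeneousIdeal_veronese]
    exact veronese_resolution
  · have hI := homogeneousIdeal_curve (K := K) hm hf hirr hF hFf
    refine ⟨hI, ?_, ⟨curveIsoCone hF⟩⟩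
    rw [hI]
    exact curve_resolution hm hF (hFf ▸ hirr.ne_zero)
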